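/- Let $n\ge 1$ and let $z_j=(x_j+ip_j)/\sqrt2$, $I_j=\tfrac12(x_j^2+p_j^2)$ $(j=1,\dots,n)$ on the phase space $\mathbb R^{2n}$ with coordinates $(x,p)$ and Poisson bracket normalized by $\{z_i,\bar z_j\}=i\delta_{ij}$. A set of $2n-k$ smooth functions $F=(F_1,\dots,F_k;F_{k+1},\dots,F_{2n-k})$ on $\mathbb R^{2n}$ is called an integrable set with $k$ central elements $(F_1,\dots,F_k)$ if it is functionally independent (the differentials are linearly independent at all points of an open dense set) and $\{F_i,F_j\}=0$ for all $i\le k$ and all $j\le 2n-k$. Let the $n$ indices be divided into $u$ nonempty groups $G_1,\dots,G_u$, with $q_b=\#G_b$, and let the frequencies be $l_i=\epsilon_i s_b$ for $i\in G_b$, where $\epsilon_i=\pm1$ and $s_1,\dots,s_u$ are positive integers (not necessarily distinct); the hamiltonian is $F_1=\sum_i l_iI_i$. Put $w_i=z_i$ if $\epsilon_i=1$ and $w_i=\bar z_i$ if $\epsilon_i=-1$, and $$P_{ij}=i(w_i\bar w_j-w_j\bar w_i),\qquad K_b=\sum_{i\in G_b}\epsilon_iI_i,\qquad W_b=\sum_{i\in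 G_b}\epsilon_iw_i^2 .$$ For $r,m\in\mathbb Z^u$ put $J_r=\sum_b r_bK_b$ and $R_m=\prod_b\Omega_b^{m_b}$, where $\Omega_b^{m_b}=W_b^{m_b}$ if $m_b\ge0$ and $\Omega_b^{m_b}=\overline{W_b}^{\,-m_b}$ if $m_b<0$. Let $P_{(b)}$ be the set of the $P_{ij}$ with $i<j$, $i,j\in G_b$. For each $b$ let $z_b=0$ if $q_b=1$, and let $z_b\in\{1,\dots,q_b-1\}$ be arbitrary if $q_b>1$; put $z=\sum_bz_b$. Consider, for each $b$, sets $Z_b$ of $z_b$ and $L_b$ of $2(q_b-z_b-1)$ polynomials of degree $\le2$ in the momenta $P_{(b)}$ such that $(Z_b,L_b)$ is functionally independent and each element of $Z_b$ is in involution with each element of $(Z_b,L_b)$ (both sets are empty if $q_b=1$). Let $1\le k'\le u/2$, $k'\le h$, and let $m^{(1)},\dots,m^{(h)}\in\mathbb Z^u$ be linearly independent with $m^{(i)}\cdot s=0$ for all $i$, and $m^{(i)}_pm^{(j)}_p=0$ for all $1\le i\le h$, $1\le j\le k'$ with $i\ne j$, and all $p=1,\dots,u$. Let $r^{(1)},\dots,r^{(u-k')}\in\mathbb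 Z^u$ be linearly independent with $r^{(1)}=s$, $r^{(i)}\cdot m^{(j)}=0$ for all $i$ and all $j\le k'$, and $r^{(i)}\cdot m^{(j)}=0$ for $i\le u-h$ and $k'<j\le h$. Put $$\mathcal J_1=(J_{r^{(1)}},\dots,J_{r^{(u-h)}}),\quad \mathcal J_2=(J_{r^{(u-h+1)}},\dots,J_{r^{(u-k')}}),$$ $$\mathcal R_1=(\mathrm{Im}\,R_{m^{(1)}},\dots,\mathrm{Im}\,R_{m^{(k')}}),\quad \mathcal R_2=(\mathrm{Im}\,R_{m^{(k'+1)}},\dots,\mathrm{Im}\,R_{m^{(h)}}),$$ $$\mathcal Z=(Z_1,\dots,Z_u),\quad \mathcal L=(L_1,\dots,L_u).$$ Then sets $Z_b,L_b$ as above exist for every $b$, one has $J_{r^{(1)}}=F_1$, and for every choice of such $Z_b,L_b$ the set $$F=(\mathcal J_1,\mathcal R_1,\mathcal Z;\mathcal J_2,\mathcal R_2,\mathcal L)$$ is an integrable set with $k=u-h+k'+z$ central elements $(\mathcal J_1,\mathcal R_1,\mathcal Z)$; in particular it has $2n-k$ elements. -/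

import Mathlib

open scoped ContDiff

namespace ResonantOscillators

/-- The phase space `ℝⁿ × ℝⁿ` of `n` oscillators, with points `y = (x, p)`. -/
abbrev Phase (n : ℕ) : Type := (Fin n → ℝ) × (Fin n → ℝ)

/-- The Poisson bracket `{f, g} = ∑ᵢ (∂f/∂pᵢ ∂g/∂xᵢ - ∂f/∂xᵢ ∂g/∂pᵢ)`; with this sign,
`{zᵢ, z̄ⱼ} = i δᵢⱼ` for `z = (x + i p) / √2`. -/
noncomputable def poissonBracket {n : ℕ} (f g : Phase n → ℝ) : Phase n → ℝ := fun y =>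
  ∑ i : Fin n,
    (fderiv ℝ f y (0, Pi.single i 1) * fderiv ℝ g y (Pi.single i 1, 0) -
      fderiv ℝ f y (Pi.single i 1, 0) * fderiv ℝ g y (0, Pi.single i 1))

/-- Functional independence: the differentials are linearly independent at every point of
some open dense subset of the phase space. -/
def FunctionallyIndependent {n : ℕ} {ι : Type*} (F : ι → Phase n → ℝ) : Prop :=
  ∃ U : Set (Phase n), IsOpen U ∧ Dense U ∧
    ∀ y ∈ U, LinearIndependent ℝ (fun i => fderiv ℝ (F i) y)

/-- `(A; B)` is an integrable set of functions on the `2n`-dimensional phase space, with the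
`k` central elements `A`: it consists of `2n - k` smooth functions, it is functionally
independent, and every element of `A` is in involution with every element of `(A; B)`. -/
structure IsIntegrableSet {n : ℕ} {ι κ : Type*} [Fintype ι] [Fintype κ] (k : ℕ)
    (A : ι → Phase n → ℝ) (B : κ → Phase n → ℝ) : Prop where
  smooth_central : ∀ i, ContDiff ℝ ∞ (A i)
  smooth_other : ∀ j, ContDiff ℝ ∞ (B j)
  card_central : Fintype.card ι = k
  card_total : Fintype.card ι + Fintype.card κ + k = 2 * n
  independent : FunctionallyIndependent (Sum.elim A B)
  involution_central : ∀ i j, poissonBracket (A i) (A j) = 0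
  involution_other : ∀ i j, poissonBracket (A i) (B j) = 0

/-- `Iᵢ = (pᵢ² + xᵢ²) / 2`. -/
noncomputable def action {n : ℕ} (i : Fin n) (y : Phase n) : ℝ :=
  (y.2 i ^ 2 + y.1 i ^ 2) / 2

/-- The hamiltonian `F₁ = l₁ I₁ + ⋯ + lₙ Iₙ` of linear oscillators with frequencies `l`. -/
noncomputable def hamiltonian {n : ℕ} (l : Fin n → ℤ) (y : Phase n) : ℝ :=
  ∑ i, (l i : ℝ) * action i y

/-- `zⱼ = (xⱼ + i pⱼ) / √2`. -/
noncomputable def zCoord {n : ℕ} (j : Fin n) (y : Phase n) : ℂ :=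
  ((y.1 j : ℂ) + Complex.I * (y.2 j : ℂ)) / ((Real.sqrt 2 : ℝ) : ℂ)

/-- `wⱼ = zⱼ` if `εⱼ = 1`, and `wⱼ = z̄ⱼ` if `εⱼ = -1`. -/
noncomputable def wCoord {n : ℕ} (ε : Fin n → ℤˣ) (j : Fin n) (y : Phase n) : ℂ :=
  if ε j = 1 then zCoord j y else star (zCoord j y)

/-- The momentum `P_{ij} = i (wᵢ w̄ⱼ - wⱼ w̄ᵢ)`, a real-valued function
(see `coe_momentum`). -/
noncomputable def momentum {n : ℕ} (ε : Fin n → ℤˣ) (i j : Fin n) (y : Phase n) : ℝ :=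
  (Complex.I *
    (wCoord ε i y * star (wCoord ε j y) - wCoord ε j y * star (wCoord ε i y))).re

theorem coe_momentum {n : ℕ} (ε : Fin n → ℤˣ) (i j : Fin n) (y : Phase n) :
    (momentum ε i j y : ℂ) = Complex.I *
      (wCoord ε i y * star (wCoord ε j y) - wCoord ε j y * star (wCoord ε i y)) := by
  apply Complex.ext
  · simp [momentum]
  · simp
    ring

section Groups

variable {n u : ℕ}

/-- The number `q_b` of oscillators in the group `b`, for the division of the oscillators into
groups given by `g`, where `g i` is the group to which the `i`-th oscillator belongs. -/
def groupSize (g : Fin n → Fin u) (b : Fin u) : ℕ :=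
  (Finset.univ.filter fun i => g i = b).card

/-- `K_b = ∑ εᵢ Iᵢ`, the sum being over the group `b`. -/
noncomputable def groupAction (ε : Fin n → ℤˣ) (g : Fin n → Fin u) (b : Fin u)
    (y : Phase n) : ℝ :=
  ∑ i ∈ Finset.univ.filter (fun i => g i = b), ((ε i : ℤ) : ℝ) * action i y

/-- `W_b = ∑ εᵢ wᵢ²`, the sum being over the group `b`. -/
noncomputable def groupW (ε : Fin n → ℤˣ) (g : Fin n → Fin u) (b : Fin u)
    (y : Phase n) : ℂ :=
  ∑ i ∈ Finset.univ.filter (fun i => g i = b), ((ε i : ℤ) : ℂ) * wCoord ε i y ^ 2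

/-- `J_r = ∑_b r_b K_b`. -/
noncomputable def J (ε : Fin n → ℤˣ) (g : Fin n → Fin u) (r : Fin u → ℤ)
    (y : Phase n) : ℝ :=
  ∑ b, (r b : ℝ) * groupAction ε g b y

/-- `R_m = ∏_b Ω_b^{m_b}`, where `Ω_b^{m_b}` is `W_b ^ m_b` if `m_b ≥ 0`, and
`W̄_b ^ (-m_b)` if `m_b < 0`. -/
noncomputable def R (ε : Fin n → ℤˣ) (g : Fin n → Fin u) (m : Fin u → ℤ)
    (y : Phase n) : ℂ :=
  ∏ b, if 0 ≤ m b then groupW ε g b y ^ (m b).toNat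
    else star (groupW ε g b y) ^ (-m b).toNat

/-- `Im R_m` as a real function on the phase space. -/
noncomputable def imR (ε : Fin n → ℤˣ) (g : Fin n → Fin u) (m : Fin u → ℤ)
    (y : Phase n) : ℝ :=
  (R ε g m y).im

/-- The pairs `i < j` of indices in the group `b`. They label the set `P_(b)` of the momenta
`P_{ij}` of this group. -/
abbrev GroupPair (g : Fin n → Fin u) (b : Fin u) : Type :=
  {ij : Fin n × Fin n // g ij.1 = b ∧ g ij.2 = b ∧ ij.1 < ij.2}

/-- The function on the phase space obtained by putting the momenta `P_(b)` of the group `b`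
in the place of the variables of the polynomial `f`. -/
noncomputable def evalMomenta (ε : Fin n → ℤˣ) (g : Fin n → Fin u) {b : Fin u}
    (f : MvPolynomial (GroupPair g b) ℝ) (y : Phase n) : ℝ :=
  MvPolynomial.eval (fun v : GroupPair g b => momentum ε v.1.1 v.1.2 y) f

/-- `Z = Z_{q,z}(P_(b))` and `L = L_{q,z}(P_(b))`, with `q = q_b`, are sets of `z` and of
`2(q - z - 1)` polynomials of degree at most two in the momenta of the group `b`, such that
`(Z, L)` is functionally independent and every element of `Z` is in involution with every
element of `(Z, L)`. -/
structure IsMomentumSystem (ε : Fin n → ℤˣ) (g : Fin n → Fin u) (b : Fin u) (z : ℕ)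
    (Z : Fin z → MvPolynomial (GroupPair g b) ℝ)
    (L : Fin (2 * (groupSize g b - z - 1)) → MvPolynomial (GroupPair g b) ℝ) : Prop where
  degree_Z : ∀ i, (Z i).totalDegree ≤ 2
  degree_L : ∀ j, (L j).totalDegree ≤ 2
  independent : FunctionallyIndependent
    (Sum.elim (fun i => evalMomenta ε g (Z i)) (fun j => evalMomenta ε g (L j)))
  involution_Z : ∀ i j,
    poissonBracket (evalMomenta ε g (Z i)) (evalMomenta ε g (Z j)) = 0
  involution_L : ∀ i j,
    poissonBracket (evalMomenta ε g (Z i)) (evalMomenta ε g (L j)) = 0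

end Groups

end ResonantOscillators

open ResonantOscillators

/-! For a set `S` of oscillators let `X_S`, `Y_S`, `Q_S` be the Gram entries of the vectors `x` and
`εp` for the quadratic form with signs `ε`. For a group `b` they give `K_b = (X + Y)/2` and `W_b =
(X - Y)/2 + iQ`. Their Hamiltonian flows act on the pair `(x, εp)` by `SL₂`, and the momenta `P_ij`
are the 2×2 minors of this pair. So polynomials in the momenta of a group commute with every `J_r`
and `Im R_m`. The flow of `K_b` rotates `W_b` with angular velocity 2, whence `{Im R_m, J_r} = 2
(r·m) Re R_m`. Functions of disjoint sets of oscillators commute. These facts, together with the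
orthogonality and support hypotheses, give all the involutions.

Independence (`functionallyIndependent_J_imR_evalMomenta`): evaluate a relation between the
differentials on the Hamiltonian field of `K_b`. Only the `Im R_m` survive, and the independence of
the `m` removes their coefficients where `Re R_m ≠ 0`. The field of `Q_b` then isolates the `J_r`,
because `dK_b` takes the value `-2 Re W_b` on it. What is left splits by groups. The exceptional
sets are zero sets of nonzero analytic functions.

Existence (`exists_isMomentumSystem`): with `w = q - z - 1`, take the Casimirs of the nested sets of
the first `w + 2, …, q` oscillators of the group, together with `P_{0j}`, `P_{1j}` for `2 ≤ j < w +
2`. -/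

namespace ResonantOscillators

/-! ### Poisson brackets, duality and generic independence of analytic functions -/

section Calculus

variable {n : ℕ}

/-- The vector field `v` such that `{f, g} = df(v)`. -/
noncomputable def hamVec (g : Phase n → ℝ) (y : Phase n) : Phase n :=
  (fun i => -fderiv ℝ g y (0, Pi.single i 1), fun i => fderiv ℝ g y (Pi.single i 1, 0))

theorem phase_eq_sum (v : Phase n) :
    v = ∑ i, (v.1 i • ((Pi.single i 1, 0) : Phase n) + v.2 i • ((0, Pi.single i 1) : Phase n)) := by
  ext k <;> simp [Prod.fst_sum, Prod.snd_sum, Finset.sum_apply, Pi.single_apply]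

theorem map_phase_eq_sum (φ : Phase n →L[ℝ] ℝ) (v : Phase n) :
    φ v = ∑ i, (v.1 i * φ (Pi.single i 1, 0) + v.2 i * φ (0, Pi.single i 1)) := by
  conv_lhs => rw [phase_eq_sum v]
  simp only [map_sum, map_add, map_smul, smul_eq_mul]

theorem poissonBracket_eq_fderiv_hamVec (f g : Phase n → ℝ) (y : Phase n) :
    poissonBracket f g y = fderiv ℝ f y (hamVec g y) := by
  rw [map_phase_eq_sum, poissonBracket]
  refine Finset.sum_congr rfl fun i _ => ?_
  simp only [hamVec]
  ring

theorem poissonBracket_swap (f g : Phase n → ℝ) (y : Phase n) :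
    poissonBracket f g y = -poissonBracket g f y := by
  rw [poissonBracket, poissonBracket, ← Finset.sum_neg_distrib]
  refine Finset.sum_congr rfl fun i _ => ?_
  ring

/-- Antisymmetry of the bracket. It allows each bracket to be computed with the Hamiltonian field of
whichever function has the simpler one. -/
theorem fderiv_hamVec_swap (f g : Phase n → ℝ) (y : Phase n) :
    fderiv ℝ f y (hamVec g y) = -fderiv ℝ g y (hamVec f y) := by
  rw [← poissonBracket_eq_fderiv_hamVec, poissonBracket_swap, poissonBracket_eq_fderiv_hamVec]

/-- The complement of the zero set of an analytic function which does not vanish identically is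
dense. -/
theorem dense_ne_zero_of_contDiff {E : Type*} [NormedAddCommGroup E] [NormedSpace ℝ E]
    {f : E → ℝ} (hf : ContDiff ℝ ω f) {y₀ : E} (h₀ : f y₀ ≠ 0) : Dense {y | f y ≠ 0} := by
  by_contra hd
  have hint : (interior {y | f y = 0}).Nonempty := by
    rw [Set.nonempty_iff_ne_empty, Ne, interior_eq_empty_iff_dense_compl]
    exact hd
  obtain ⟨y, hy⟩ := hint
  have := (contDiff_omega_iff_analyticOnNhd.1 hf).eqOn_zero_of_preconnected_of_eventuallyEq_zero
    isPreconnected_univ (Set.mem_univ y) (mem_interior_iff_mem_nhds.1 hy)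
  exact h₀ (this (Set.mem_univ y₀))

/-- If the joint map `E → ℝ^ι` were not onto, a nonzero functional on `ℝ^ι` would vanish on its
range, and its coefficients would be a relation between the `φ i`. -/
theorem exists_dual_family {E ι : Type*} [AddCommGroup E] [Module ℝ E] [Fintype ι] [DecidableEq ι]
    {φ : ι → E →ₗ[ℝ] ℝ} (hφ : LinearIndependent ℝ φ) :
    ∃ v : ι → E, ∀ i j, φ i (v j) = if i = j then 1 else 0 := by
  have hs : LinearMap.range (LinearMap.pi φ) = ⊤ := by
    by_contra hne
    obtain ⟨ψ, hψ, hle⟩ := Submodule.exists_le_ker_of_lt_top _ (lt_top_iff_ne_top.2 hne)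
    rw [Fintype.linearIndependent_iff] at hφ
    have hval : ∀ w : ι → ℝ, ψ w = ∑ i, ψ (Pi.single i 1) * w i := fun w => by
      conv_lhs => rw [pi_eq_sum_univ' w]
      rw [map_sum]
      exact Finset.sum_congr rfl fun i _ => by simp [mul_comm]
    have h0 := hφ (fun i => ψ (Pi.single i 1)) (by
      ext x
      have := hle ⟨x, rfl⟩
      rw [LinearMap.mem_ker, hval] at this
      simpa using this)
    exact hψ (LinearMap.ext fun w => by rw [hval]; simp [h0])
  choose v hv using fun j => LinearMap.range_eq_top.1 hs (Pi.single j 1)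
  refine ⟨v, fun i j => ?_⟩
  have := congrFun (hv j) i
  simpa [Pi.single_apply] using this

/-- Analytic functions whose differentials are linearly independent at one point are functionally
independent. -/
theorem functionallyIndependent_of_point {ι : Type*} [Fintype ι] {F : ι → Phase n → ℝ}
    (hF : ∀ i, ContDiff ℝ ω (F i)) (y₀ : Phase n)
    (h₀ : LinearIndependent ℝ fun i => fderiv ℝ (F i) y₀) : FunctionallyIndependent F := by
  classical
  obtain ⟨v, hv⟩ := exists_dual_family (φ := fun i => (fderiv ℝ (F i) y₀ : Phase n →ₗ[ℝ] ℝ))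
    (h₀.map' (ContinuousLinearMap.coeLM ℝ) (LinearMap.ker_eq_bot.2
      ContinuousLinearMap.coe_injective))
  -- The dual vectors stay fixed while `y` varies, so `d` is analytic. It equals 1 at `y₀`, and a
  -- relation between the differentials at `y` forces `d y = 0`.
  let d : Phase n → ℝ := fun y => (Matrix.of fun i j => fderiv ℝ (F i) y (v j)).det
  have hd : ContDiff ℝ ω d := by
    have hentry : ∀ i j, ContDiff ℝ ω fun y => fderiv ℝ (F i) y (v j) := fun i j =>
      ((hF i).fderiv_right (m := ω) (by simp)).clm_apply contDiff_const
    simp only [d, Matrix.det_apply, Matrix.of_apply]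
    refine ContDiff.sum fun σ _ => ContDiff.const_smul _ (contDiff_prod fun i _ => hentry _ _)
  have hd₀ : d y₀ ≠ 0 := by
    have : (Matrix.of fun i j => fderiv ℝ (F i) y₀ (v j)) = 1 := by
      ext i j
      simpa [Matrix.one_apply] using hv i j
    simp [d, this]
  refine ⟨{y | d y ≠ 0}, isOpen_ne_fun hd.continuous continuous_const,
    dense_ne_zero_of_contDiff hd hd₀, fun y hy => ?_⟩
  rw [Fintype.linearIndependent_iff]
  intro c hc
  refine congrFun (Matrix.eq_zero_of_vecMul_eq_zero hy (v := c) ?_)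
  ext j
  simpa [Matrix.vecMul, dotProduct] using DFunLike.congr_fun hc (v j)

end Calculus

/-! ### The momenta and the quadratic invariants `X`, `Y`, `Q` -/

section Momenta

variable {n : ℕ}

theorem coe_units_sq (e : ℤˣ) : ((e : ℤ) : ℝ) ^ 2 = 1 := by
  rcases Int.units_eq_one_or e with h | h <;> simp [h]

theorem coe_units_ne_zero (e : ℤˣ) : ((e : ℤ) : ℝ) ≠ 0 := by
  rcases Int.units_eq_one_or e with h | h <;> simp [h]

/-- Since `wⱼ = (xⱼ + i εⱼ pⱼ)/√2`, the momentum is the 2×2 minor of the pair `(x, εp)` at the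
indices `i`, `j`. -/
theorem momentum_eq (ε : Fin n → ℤˣ) (i j : Fin n) (y : Phase n) :
    momentum ε i j y = ((ε j : ℤ) : ℝ) * (y.1 i * y.2 j) - ((ε i : ℤ) : ℝ) * (y.1 j * y.2 i) := by
  have h2 : Real.sqrt 2 * Real.sqrt 2 = 2 := Real.mul_self_sqrt (by norm_num)
  have h0 : Real.sqrt 2 ≠ 0 := by positivity
  rcases Int.units_eq_one_or (ε i) with hi | hi <;> rcases Int.units_eq_one_or (ε j) with hj | hj <;>
    simp [momentum, wCoord, zCoord, hi, hj, Complex.div_re, Complex.div_im, Complex.normSq_apply, h2,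
      show (-1 : ℤˣ) ≠ 1 by decide] <;> field_simp <;> rw [Real.sq_sqrt zero_le_two] <;> ring

theorem wCoord_sq (ε : Fin n → ℤˣ) (i : Fin n) (y : Phase n) :
    wCoord ε i y ^ 2 = (((y.1 i ^ 2 - y.2 i ^ 2) / 2 : ℝ) : ℂ) +
      Complex.I * ((((ε i : ℤ) : ℝ) * (y.1 i * y.2 i) : ℝ) : ℂ) := by
  have h2 : Real.sqrt 2 * Real.sqrt 2 = 2 := Real.mul_self_sqrt (by norm_num)
  have h0 : Real.sqrt 2 ≠ 0 := by positivity
  apply Complex.ext <;> rcases Int.units_eq_one_or (ε i) with hi | hi <;>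
    simp [wCoord, zCoord, hi, sq, Complex.div_re, Complex.div_im, Complex.normSq_apply, h2,
      show (-1 : ℤˣ) ≠ 1 by decide] <;> field_simp <;> rw [Real.sq_sqrt zero_le_two] <;> ring

theorem contDiff_momentum (ε : Fin n → ℤˣ) (i j : Fin n) : ContDiff ℝ ω (momentum ε i j) := by
  simp only [funext (momentum_eq ε i j)]
  fun_prop

theorem hasFDerivAt_fst_apply (i : Fin n) (y : Phase n) :
    HasFDerivAt (fun y : Phase n => y.1 i)
      ((ContinuousLinearMap.proj i).comp (ContinuousLinearMap.fst ℝ (Fin n → ℝ) (Fin n → ℝ))) y :=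
  ContinuousLinearMap.hasFDerivAt
    ((ContinuousLinearMap.proj i).comp (ContinuousLinearMap.fst ℝ (Fin n → ℝ) (Fin n → ℝ)))

theorem hasFDerivAt_snd_apply (i : Fin n) (y : Phase n) :
    HasFDerivAt (fun y : Phase n => y.2 i)
      ((ContinuousLinearMap.proj i).comp (ContinuousLinearMap.snd ℝ (Fin n → ℝ) (Fin n → ℝ))) y :=
  ContinuousLinearMap.hasFDerivAt
    ((ContinuousLinearMap.proj i).comp (ContinuousLinearMap.snd ℝ (Fin n → ℝ) (Fin n → ℝ)))

theorem fderiv_momentum (ε : Fin n → ℤˣ) (i j : Fin n) (y v : Phase n) :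
    fderiv ℝ (momentum ε i j) y v =
      ((ε j : ℤ) : ℝ) * (v.1 i * y.2 j + y.1 i * v.2 j) -
        ((ε i : ℤ) : ℝ) * (v.1 j * y.2 i + y.1 j * v.2 i) := by
  have h := (((hasFDerivAt_fst_apply i y).mul (hasFDerivAt_snd_apply j y)).const_mul
    ((ε j : ℤ) : ℝ)).sub (((hasFDerivAt_fst_apply j y).mul (hasFDerivAt_snd_apply i y)).const_mul
    ((ε i : ℤ) : ℝ))
  have h' : HasFDerivAt (momentum ε i j) _ y :=
    h.congr_of_eventuallyEq (Filter.Eventually.of_forall fun y => momentum_eq ε i j y)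
  rw [h'.fderiv]
  simp
  ring

/-- `X_S = ∑ εᵢ xᵢ²`. -/
noncomputable def quadX (ε : Fin n → ℤˣ) (S : Finset (Fin n)) (y : Phase n) : ℝ :=
  ∑ i ∈ S, ((ε i : ℤ) : ℝ) * (y.1 i * y.1 i)

/-- `Y_S = ∑ εᵢ pᵢ²`. -/
noncomputable def quadY (ε : Fin n → ℤˣ) (S : Finset (Fin n)) (y : Phase n) : ℝ :=
  ∑ i ∈ S, ((ε i : ℤ) : ℝ) * (y.2 i * y.2 i)

/-- `Q_S = ∑ xᵢ pᵢ`. -/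
noncomputable def quadQ (S : Finset (Fin n)) (y : Phase n) : ℝ :=
  ∑ i ∈ S, y.1 i * y.2 i

theorem contDiff_quadX (ε : Fin n → ℤˣ) (S : Finset (Fin n)) : ContDiff ℝ ω (quadX ε S) := by
  unfold quadX
  fun_prop

theorem contDiff_quadY (ε : Fin n → ℤˣ) (S : Finset (Fin n)) : ContDiff ℝ ω (quadY ε S) := by
  unfold quadY
  fun_prop

theorem contDiff_quadQ (S : Finset (Fin n)) : ContDiff ℝ ω (quadQ S) := by
  unfold quadQ
  fun_prop

theorem fderiv_quadX (ε : Fin n → ℤˣ) (S : Finset (Fin n)) (y v : Phase n) :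
    fderiv ℝ (quadX ε S) y v = ∑ i ∈ S, 2 * ((ε i : ℤ) : ℝ) * (y.1 i * v.1 i) := by
  have h := HasFDerivAt.fun_sum (u := S) fun i _ =>
    ((hasFDerivAt_fst_apply i y).mul (hasFDerivAt_fst_apply i y)).const_mul ((ε i : ℤ) : ℝ)
  have h' : HasFDerivAt (quadX ε S) _ y := h
  rw [h'.fderiv, sum_apply]
  refine Finset.sum_congr rfl fun i _ => ?_
  simp
  ring

theorem fderiv_quadY (ε : Fin n → ℤˣ) (S : Finset (Fin n)) (y v : Phase n) :
    fderiv ℝ (quadY ε S) y v = ∑ i ∈ S, 2 * ((ε i : ℤ) : ℝ) * (y.2 i * v.2 i) := by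
  have h := HasFDerivAt.fun_sum (u := S) fun i _ =>
    ((hasFDerivAt_snd_apply i y).mul (hasFDerivAt_snd_apply i y)).const_mul ((ε i : ℤ) : ℝ)
  have h' : HasFDerivAt (quadY ε S) _ y := h
  rw [h'.fderiv, sum_apply]
  refine Finset.sum_congr rfl fun i _ => ?_
  simp
  ring

theorem fderiv_quadQ (S : Finset (Fin n)) (y v : Phase n) :
    fderiv ℝ (quadQ S) y v = ∑ i ∈ S, (y.1 i * v.2 i + v.1 i * y.2 i) := by
  have h := HasFDerivAt.fun_sum (u := S) fun i _ =>
    (hasFDerivAt_fst_apply i y).mul (hasFDerivAt_snd_apply i y)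
  have h' : HasFDerivAt (quadQ S) _ y := h
  rw [h'.fderiv, sum_apply]
  refine Finset.sum_congr rfl fun i _ => ?_
  simp
  ring

theorem hamVec_quadX (ε : Fin n → ℤˣ) (S : Finset (Fin n)) (y : Phase n) :
    hamVec (quadX ε S) y = (0, fun i => if i ∈ S then 2 * ((ε i : ℤ) : ℝ) * y.1 i else 0) := by
  ext k <;> simp [hamVec, fderiv_quadX, Pi.single_apply]

theorem hamVec_quadY (ε : Fin n → ℤˣ) (S : Finset (Fin n)) (y : Phase n) :
    hamVec (quadY ε S) y = (fun i => if i ∈ S then -(2 * ((ε i : ℤ) : ℝ) * y.2 i) else 0, 0) := by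
  ext k <;> simp [hamVec, fderiv_quadY, Pi.single_apply]
  split_ifs <;> simp

theorem hamVec_quadQ (S : Finset (Fin n)) (y : Phase n) :
    hamVec (quadQ S) y =
      (fun i => if i ∈ S then -y.1 i else 0, fun i => if i ∈ S then y.2 i else 0) := by
  ext k <;> simp [hamVec, fderiv_quadQ, Pi.single_apply]
  split_ifs <;> simp

/-- On the indices in `S` the flow adds a multiple of `x` to `εp`, which preserves the minors;
outside `S` nothing moves. Likewise `Y_S` adds a multiple of `εp` to `x`, and `Q_S` scales `x` and
`εp` by inverse factors. -/
theorem fderiv_momentum_hamVec_quadX (ε : Fin n → ℤˣ) {S : Finset (Fin n)} {i j : Fin n}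
    (h : i ∈ S ↔ j ∈ S) (y : Phase n) :
    fderiv ℝ (momentum ε i j) y (hamVec (quadX ε S) y) = 0 := by
  rw [fderiv_momentum, hamVec_quadX]
  by_cases hi : i ∈ S
  · simp only [hi, h.1 hi, if_true, Pi.zero_apply]
    linear_combination 2 * (y.1 i * y.1 j) * (coe_units_sq (ε j) - coe_units_sq (ε i))
  · simp [hi, mt h.2 hi]

theorem fderiv_momentum_hamVec_quadY (ε : Fin n → ℤˣ) {S : Finset (Fin n)} {i j : Fin n}
    (h : i ∈ S ↔ j ∈ S) (y : Phase n) :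
    fderiv ℝ (momentum ε i j) y (hamVec (quadY ε S) y) = 0 := by
  rw [fderiv_momentum, hamVec_quadY]
  by_cases hi : i ∈ S
  · simp only [hi, h.1 hi, if_true, Pi.zero_apply]
    ring
  · simp [hi, mt h.2 hi]

theorem fderiv_momentum_hamVec_quadQ (ε : Fin n → ℤˣ) {S : Finset (Fin n)} {i j : Fin n}
    (h : i ∈ S ↔ j ∈ S) (y : Phase n) :
    fderiv ℝ (momentum ε i j) y (hamVec (quadQ S) y) = 0 := by
  rw [fderiv_momentum, hamVec_quadQ]
  by_cases hi : i ∈ S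
  · simp only [hi, h.1 hi, if_true]
    ring
  · simp [hi, mt h.2 hi]

end Momenta

/-! ### Polynomials in the momenta of a group -/

section Polynomials

variable {n u : ℕ} (ε : Fin n → ℤˣ) (g : Fin n → Fin u) {b : Fin u}

theorem contDiff_evalMomenta (f : MvPolynomial (GroupPair g b) ℝ) :
    ContDiff ℝ ω (evalMomenta ε g f) := by
  unfold evalMomenta
  induction f using MvPolynomial.induction_on with
  | C a => simpa using contDiff_const
  | add p q hp hq => simpa using hp.add hq
  | mul_X p v hp => simpa using hp.mul (contDiff_momentum ε _ _)

theorem differentiable_evalMomenta (f : MvPolynomial (GroupPair g b) ℝ) :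
    Differentiable ℝ (evalMomenta ε g f) :=
  (contDiff_evalMomenta ε g f).differentiable (by simp)

/-- A vector annihilated by the differentials of the momenta occurring in a polynomial is
annihilated by the differential of the polynomial. -/
theorem fderiv_evalMomenta_eq_zero {f : MvPolynomial (GroupPair g b) ℝ} {y v : Phase n}
    (h : ∀ a : GroupPair g b, fderiv ℝ (momentum ε a.1.1 a.1.2) y v = 0) :
    fderiv ℝ (evalMomenta ε g f) y v = 0 := by
  induction f using MvPolynomial.induction_on with
  | C a =>
    have : evalMomenta ε g (MvPolynomial.C a : MvPolynomial (GroupPair g b) ℝ) = fun _ => a := by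
      ext; simp [evalMomenta]
    simp [this]
  | add p q hp hq =>
    have : evalMomenta ε g (p + q) = evalMomenta ε g p + evalMomenta ε g q := by
      ext; simp [evalMomenta]
    rw [this, fderiv_add (differentiable_evalMomenta ε g p y) (differentiable_evalMomenta ε g q y)]
    simp [hp, hq]
  | mul_X p a hp =>
    have : evalMomenta ε g (p * MvPolynomial.X a) =
        evalMomenta ε g p * momentum ε a.1.1 a.1.2 := by
      ext; simp [evalMomenta]
    rw [this, fderiv_mul (differentiable_evalMomenta ε g p y)
      ((contDiff_momentum ε a.1.1 a.1.2).differentiable (by simp) y)]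
    simp [hp, h]

end Polynomials

/-! ### The functions `K_b`, `W_b`, `J_r`, `R_m` and their differentials -/

section GroupFunctions

variable {n u : ℕ} (ε : Fin n → ℤˣ) (g : Fin n → Fin u)

/-- The oscillators of the group `b`. -/
abbrev members (b : Fin u) : Finset (Fin n) := Finset.univ.filter fun i => g i = b

theorem groupAction_eq (b : Fin u) :
    groupAction ε g b = fun y => (quadX ε (members g b) y + quadY ε (members g b) y) / 2 := by
  ext y
  rw [groupAction, quadX, quadY, ← Finset.sum_add_distrib, Finset.sum_div]
  refine Finset.sum_congr rfl fun i _ => ?_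
  rw [action]
  ring

/-- The weight `εᵢ` in `W_b` cancels the sign that conjugation gives to the imaginary part of `wᵢ²`,
so that `Q` appears without signs. -/
theorem groupW_eq (b : Fin u) (y : Phase n) :
    groupW ε g b y =
      (((quadX ε (members g b) y - quadY ε (members g b) y) / 2 : ℝ) : ℂ) +
        Complex.I * ((quadQ (members g b) y : ℝ) : ℂ) := by
  rw [groupW, quadX, quadY, quadQ, ← Finset.sum_sub_distrib, Finset.sum_div]
  push_cast
  rw [Finset.mul_sum, ← Finset.sum_add_distrib]
  refine Finset.sum_congr rfl fun i _ => ?_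
  have h : ((ε i : ℤ) : ℂ) * ((ε i : ℤ) : ℂ) = 1 := by
    rw [← sq]; exact_mod_cast coe_units_sq (ε i)
  rw [wCoord_sq]
  push_cast
  linear_combination Complex.I * (y.1 i * y.2 i) * h

theorem groupW_re (b : Fin u) (y : Phase n) :
    (groupW ε g b y).re = (quadX ε (members g b) y - quadY ε (members g b) y) / 2 := by
  simp [groupW_eq]

theorem contDiff_groupAction (b : Fin u) : ContDiff ℝ ω (groupAction ε g b) := by
  rw [groupAction_eq]
  exact ((contDiff_quadX _ _).add (contDiff_quadY _ _)).div_const 2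

theorem contDiff_J (r : Fin u → ℤ) : ContDiff ℝ ω (J ε g r) := by
  unfold J
  exact ContDiff.sum fun b _ => contDiff_const.mul (contDiff_groupAction ε g b)

theorem contDiff_groupW (b : Fin u) : ContDiff ℝ ω (groupW ε g b) := by
  rw [funext (groupW_eq ε g b)]
  exact (Complex.ofRealCLM.contDiff.comp
    (((contDiff_quadX _ _).sub (contDiff_quadY _ _)).div_const 2)).add
    (contDiff_const.mul (Complex.ofRealCLM.contDiff.comp (contDiff_quadQ (members g b))))

theorem contDiff_R (m : Fin u → ℤ) : ContDiff ℝ ω (R ε g m) := by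
  unfold R
  refine contDiff_prod fun b _ => ?_
  split_ifs
  · exact (contDiff_groupW ε g b).pow _
  · exact ((Complex.conjCLE.contDiff).comp (contDiff_groupW ε g b)).pow _

theorem contDiff_imR (m : Fin u → ℤ) : ContDiff ℝ ω (imR ε g m) :=
  Complex.imCLM.contDiff.comp (contDiff_R ε g m)

theorem fderiv_groupAction (b : Fin u) (y v : Phase n) :
    fderiv ℝ (groupAction ε g b) y v =
      (fderiv ℝ (quadX ε (members g b)) y v + fderiv ℝ (quadY ε (members g b)) y v) / 2 := by
  have h := (((contDiff_quadX ε (members g b)).differentiable (by simp) y).hasFDerivAt.add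
    ((contDiff_quadY ε (members g b)).differentiable (by simp) y).hasFDerivAt).mul_const (2⁻¹ : ℝ)
  rw [(h.congr_of_eventuallyEq (f₁ := groupAction ε g b)
    (Filter.Eventually.of_forall fun y => by simp [groupAction_eq, div_eq_mul_inv])).fderiv]
  simp
  ring

theorem fderiv_groupW (b : Fin u) (y v : Phase n) :
    fderiv ℝ (groupW ε g b) y v =
      (((fderiv ℝ (quadX ε (members g b)) y v - fderiv ℝ (quadY ε (members g b)) y v) / 2 : ℝ) : ℂ)
        + Complex.I * ((fderiv ℝ (quadQ (members g b)) y v : ℝ) : ℂ) := by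
  have h1 := (((contDiff_quadX ε (members g b)).differentiable (by simp) y).hasFDerivAt.sub
    ((contDiff_quadY ε (members g b)).differentiable (by simp) y).hasFDerivAt).mul_const (2⁻¹ : ℝ)
  have h2 := ((contDiff_quadQ (members g b)).differentiable (by simp) y).hasFDerivAt
  have h := (Complex.ofRealCLM.hasFDerivAt.comp y h1).add
    ((Complex.ofRealCLM.hasFDerivAt.comp y h2).const_mul Complex.I)
  rw [(h.congr_of_eventuallyEq (f₁ := groupW ε g b)
    (Filter.Eventually.of_forall fun y => by simp [groupW_eq, div_eq_mul_inv])).fderiv]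
  simp
  ring

theorem fderiv_J (r : Fin u → ℤ) (y v : Phase n) :
    fderiv ℝ (J ε g r) y v = ∑ b, (r b : ℝ) * fderiv ℝ (groupAction ε g b) y v := by
  have h := HasFDerivAt.fun_sum (u := Finset.univ) fun b _ =>
    ((contDiff_groupAction ε g b).differentiable (by simp) y).hasFDerivAt.const_mul (r b : ℝ)
  have h' : HasFDerivAt (J ε g r) _ y := h
  rw [h'.fderiv, sum_apply]
  simp

/-- If the functions `W_b` occurring in `R_m` are rotated by the vector `v` with the angular
velocities `2 ρ_b`, then `R_m` is rotated with the angular velocity `2 ∑ ρ_b m_b`. -/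
theorem fderiv_R {m : Fin u → ℤ} {y v : Phase n} (ρ : Fin u → ℝ)
    (h : ∀ b, m b ≠ 0 → fderiv ℝ (groupW ε g b) y v = 2 * Complex.I * ρ b * groupW ε g b y) :
    fderiv ℝ (R ε g m) y v = 2 * Complex.I * (∑ b, ρ b * m b : ℝ) * R ε g m y := by
  let f : Fin u → Phase n → ℂ := fun b y => if 0 ≤ m b then groupW ε g b y ^ (m b).toNat
    else star (groupW ε g b y) ^ (-m b).toNat
  have hf : ∀ b, ∃ f' : Phase n →L[ℝ] ℂ, HasFDerivAt (f b) f' y ∧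
      f' v = 2 * Complex.I * (ρ b * m b) * f b y := by
    intro b
    have hW := ((contDiff_groupW ε g b).differentiable (by simp) y).hasFDerivAt
    -- Here nothing is known about the differential of `W_b`, but the factor is the constant 1.
    by_cases h0 : m b = 0
    · refine ⟨0, ?_, by simp [h0]⟩
      simp only [f, h0]
      simpa using hasFDerivAt_const (1 : ℂ) y
    by_cases hm : 0 ≤ m b
    · have hfb := (hW.pow (m b).toNat).congr_of_eventuallyEq (f₁ := f b)
        (Filter.Eventually.of_forall fun y => by simp [f, hm])
      refine ⟨_, hfb, ?_⟩
      obtain ⟨k, hk⟩ : ∃ k : ℕ, m b = k + 1 := ⟨(m b - 1).toNat, by omega⟩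
      have hk' : (m b).toNat = k + 1 := by omega
      have hfy : f b y = groupW ε g b y ^ (k + 1) := by simp only [f, hm, if_true, hk']
      rw [hfy]
      simp [h b h0, hk, pow_succ]
      ring
    -- Conjugation reverses the rotation and the exponent is `-m b`; the two signs cancel, so the
    -- velocity is again proportional to `m b`.
    · have hW' := Complex.conjCLE.hasFDerivAt.comp y hW
      have hfb := (hW'.pow (-m b).toNat).congr_of_eventuallyEq (f₁ := f b)
        (Filter.Eventually.of_forall fun y => by simp [f, hm])
      refine ⟨_, hfb, ?_⟩
      obtain ⟨k, hk⟩ : ∃ k : ℕ, m b = -(k + 1) := ⟨(-m b - 1).toNat, by omega⟩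
      have hk' : (-m b).toNat = k + 1 := by omega
      have hfy : f b y = star (groupW ε g b y) ^ (k + 1) := by simp only [f, hm, if_false, hk']
      rw [hfy]
      simp [h b h0, hk, pow_succ, Complex.conj_ofNat]
      ring
  choose f' hf' hv using hf
  have hR : HasFDerivAt (R ε g m) _ y := HasFDerivAt.finsetProd fun b _ => hf' b
  rw [hR.fderiv, sum_apply]
  simp only [smul_apply, hv, smul_eq_mul]
  push_cast
  rw [Finset.mul_sum, Finset.sum_mul]
  refine Finset.sum_congr rfl fun b hb => ?_
  rw [show R ε g m y = ∏ b, f b y from rfl, ← Finset.mul_prod_erase _ _ hb]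
  ring

theorem fderiv_imR {m : Fin u → ℤ} {y v : Phase n} (ρ : Fin u → ℝ)
    (h : ∀ b, m b ≠ 0 → fderiv ℝ (groupW ε g b) y v = 2 * Complex.I * ρ b * groupW ε g b y) :
    fderiv ℝ (imR ε g m) y v = 2 * (∑ b, ρ b * m b) * (R ε g m y).re := by
  have hR := ((contDiff_R ε g m).differentiable (by simp) y).hasFDerivAt
  have h' : HasFDerivAt (imR ε g m) _ y := Complex.imCLM.hasFDerivAt.comp y hR
  rw [h'.fderiv, ContinuousLinearMap.comp_apply, fderiv_R ε g ρ h]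
  simp

theorem fderiv_imR_eq_zero {m : Fin u → ℤ} {y v : Phase n}
    (h : ∀ b, m b ≠ 0 → fderiv ℝ (groupW ε g b) y v = 0) : fderiv ℝ (imR ε g m) y v = 0 := by
  simpa using fderiv_imR ε g (m := m) (y := y) (v := v) 0 (by simpa using h)

end GroupFunctions

/-! ### Bracket relations between the functions -/

section Brackets

variable {n u : ℕ} (ε : Fin n → ℤˣ) (g : Fin n → Fin u)

theorem hamVec_groupAction (b : Fin u) (y : Phase n) :
    hamVec (groupAction ε g b) y =
      (2⁻¹ : ℝ) • (hamVec (quadX ε (members g b)) y + hamVec (quadY ε (members g b)) y) := by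
  ext k <;> simp [hamVec, fderiv_groupAction] <;> ring

theorem hamVec_J (r : Fin u → ℤ) (y : Phase n) :
    hamVec (J ε g r) y = ∑ b, (r b : ℝ) • hamVec (groupAction ε g b) y := by
  ext k <;> simp [hamVec, fderiv_J, Prod.fst_sum, Prod.snd_sum, Finset.sum_apply]

theorem fderiv_momentum_hamVec_groupAction {i j : Fin n} (hij : g i = g j) (b : Fin u)
    (y : Phase n) : fderiv ℝ (momentum ε i j) y (hamVec (groupAction ε g b) y) = 0 := by
  have hS : i ∈ members g b ↔ j ∈ members g b := by simp [hij]
  rw [hamVec_groupAction, map_smul, map_add, fderiv_momentum_hamVec_quadX ε hS,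
    fderiv_momentum_hamVec_quadY ε hS]
  simp

theorem members_mem_iff_eq {b b' : Fin u} {i : Fin n} (hi : i ∈ members g b) :
    i ∈ members g b' ↔ b = b' := by
  simp only [Finset.mem_filter_univ] at hi ⊢
  rw [hi]

theorem fderiv_groupAction_hamVec_quadX (b b' : Fin u) (y : Phase n) :
    fderiv ℝ (groupAction ε g b) y (hamVec (quadX ε (members g b')) y) =
      if b = b' then 2 * quadQ (members g b) y else 0 := by
  rw [fderiv_groupAction, hamVec_quadX, fderiv_quadX, fderiv_quadY]
  simp only [Pi.zero_apply, mul_zero, Finset.sum_const_zero, zero_add]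
  rw [Finset.sum_congr rfl fun i hi => by rw [if_congr (members_mem_iff_eq g hi) rfl rfl]]
  split_ifs
  · rw [quadQ, Finset.mul_sum, Finset.sum_div]
    refine Finset.sum_congr rfl fun i _ => ?_
    linear_combination 2 * (y.1 i * y.2 i) * coe_units_sq (ε i)
  · simp

theorem fderiv_groupAction_hamVec_quadY (b b' : Fin u) (y : Phase n) :
    fderiv ℝ (groupAction ε g b) y (hamVec (quadY ε (members g b')) y) =
      if b = b' then -(2 * quadQ (members g b) y) else 0 := by
  rw [fderiv_groupAction, hamVec_quadY, fderiv_quadX, fderiv_quadY]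
  simp only [Pi.zero_apply, mul_zero, Finset.sum_const_zero, add_zero]
  rw [Finset.sum_congr rfl fun i hi => by rw [if_congr (members_mem_iff_eq g hi) rfl rfl]]
  split_ifs
  · rw [quadQ, Finset.mul_sum, Finset.sum_div, ← Finset.sum_neg_distrib]
    refine Finset.sum_congr rfl fun i _ => ?_
    linear_combination -2 * (y.1 i * y.2 i) * coe_units_sq (ε i)
  · simp

theorem fderiv_groupAction_hamVec_quadQ (b b' : Fin u) (y : Phase n) :
    fderiv ℝ (groupAction ε g b) y (hamVec (quadQ (members g b')) y) =
      if b = b' then quadY ε (members g b) y - quadX ε (members g b) y else 0 := by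
  rw [fderiv_groupAction, hamVec_quadQ, fderiv_quadX, fderiv_quadY]
  dsimp only
  rw [← Finset.sum_add_distrib, Finset.sum_congr rfl fun i hi => by
    rw [if_congr (members_mem_iff_eq g hi) rfl rfl, if_congr (members_mem_iff_eq g hi) rfl rfl]]
  split_ifs
  · rw [quadX, quadY, ← Finset.sum_sub_distrib, Finset.sum_div]
    refine Finset.sum_congr rfl fun i _ => ?_
    ring
  · simp

/-- The contributions of `X` and `Y` are opposite multiples of `Q`. -/
theorem fderiv_groupAction_hamVec_groupAction (b b' : Fin u) (y : Phase n) :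
    fderiv ℝ (groupAction ε g b) y (hamVec (groupAction ε g b') y) = 0 := by
  rw [hamVec_groupAction, map_smul, map_add, fderiv_groupAction_hamVec_quadX,
    fderiv_groupAction_hamVec_quadY]
  split_ifs <;> simp

/-- By the `sl₂` relations, `K_b` generates a rotation in the plane of `(X - Y)/2` and `Q`. -/
theorem fderiv_groupW_hamVec_groupAction (b b' : Fin u) (y : Phase n) :
    fderiv ℝ (groupW ε g b) y (hamVec (groupAction ε g b') y) =
      if b = b' then 2 * Complex.I * groupW ε g b y else 0 := by
  rw [fderiv_groupW, fderiv_hamVec_swap _ (groupAction ε g b'),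
    fderiv_hamVec_swap _ (groupAction ε g b'), fderiv_hamVec_swap _ (groupAction ε g b'),
    fderiv_groupAction_hamVec_quadX, fderiv_groupAction_hamVec_quadY,
    fderiv_groupAction_hamVec_quadQ]
  by_cases hb : b' = b
  · subst hb
    rw [groupW_eq]
    simp only [if_true]
    push_cast
    linear_combination (-2 * (quadQ (members g b') y : ℂ)) * Complex.I_mul_I
  · simp [hb, Ne.symm hb]

theorem fderiv_groupW_hamVec_J (r : Fin u → ℤ) (b : Fin u) (y : Phase n) :
    fderiv ℝ (groupW ε g b) y (hamVec (J ε g r) y) =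
      2 * Complex.I * ((r b : ℝ) : ℂ) * groupW ε g b y := by
  simp only [hamVec_J, map_sum, map_smul, fderiv_groupW_hamVec_groupAction]
  simp
  ring

theorem fderiv_groupW_eq_zero_of_support {b : Fin u} {y v : Phase n}
    (h : ∀ i, g i = b → v.1 i = 0 ∧ v.2 i = 0) : fderiv ℝ (groupW ε g b) y v = 0 := by
  have h' : ∀ i ∈ members g b, v.1 i = 0 ∧ v.2 i = 0 := fun i hi => h i (by simpa using hi)
  rw [fderiv_groupW, fderiv_quadX, fderiv_quadY, fderiv_quadQ,
    Finset.sum_eq_zero fun i hi => by simp [h' i hi],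
    Finset.sum_eq_zero fun i hi => by simp [h' i hi],
    Finset.sum_eq_zero fun i hi => by simp [h' i hi]]
  simp

theorem fderiv_evalMomenta_eq_zero_of_support {b : Fin u} (f : MvPolynomial (GroupPair g b) ℝ)
    {y v : Phase n} (h : ∀ i, g i = b → v.1 i = 0 ∧ v.2 i = 0) :
    fderiv ℝ (evalMomenta ε g f) y v = 0 :=
  fderiv_evalMomenta_eq_zero ε g fun a => by
    simp [fderiv_momentum, h _ a.2.1, h _ a.2.2.1]

theorem fderiv_single_ne {b : Fin u} {i k : Fin n} (hi : g i = b) (hk : g k ≠ b) :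
    (((Pi.single k 1, 0) : Phase n).1 i = 0 ∧ ((Pi.single k 1, 0) : Phase n).2 i = 0) ∧
      ((0, Pi.single k 1) : Phase n).1 i = 0 ∧ ((0, Pi.single k 1) : Phase n).2 i = 0 := by
  have : i ≠ k := fun h => hk (h ▸ hi)
  simp [this]

theorem poissonBracket_J_J (r r' : Fin u → ℤ) : poissonBracket (J ε g r) (J ε g r') = 0 := by
  ext y
  rw [poissonBracket_eq_fderiv_hamVec, fderiv_J, hamVec_J]
  simp [map_sum, fderiv_groupAction_hamVec_groupAction]

/-- The flow of `J_r` turns the phase of `R_m` with velocity `2 r·m`, which vanishes at resonance.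
-/
theorem poissonBracket_imR_J {m r : Fin u → ℤ} (h : ∑ b, r b * m b = 0) :
    poissonBracket (imR ε g m) (J ε g r) = 0 := by
  ext y
  rw [poissonBracket_eq_fderiv_hamVec,
    fderiv_imR ε g (fun b => (r b : ℝ)) fun b _ => fderiv_groupW_hamVec_J ε g r b y]
  have : ∑ b, (r b : ℝ) * (m b : ℝ) = 0 := by exact_mod_cast h
  simp [this]

theorem poissonBracket_evalMomenta_J {b : Fin u} (f : MvPolynomial (GroupPair g b) ℝ)
    (r : Fin u → ℤ) : poissonBracket (evalMomenta ε g f) (J ε g r) = 0 := by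
  ext y
  rw [poissonBracket_eq_fderiv_hamVec]
  refine fderiv_evalMomenta_eq_zero ε g fun a => ?_
  simp [hamVec_J, map_sum, fderiv_momentum_hamVec_groupAction ε g (a.2.1.trans a.2.2.1.symm)]

/-- `R_m` depends only on the `X`, `Y`, `Q` of whole groups. Both indices of a momentum lie in one
group, so all these invariants commute with it. -/
theorem poissonBracket_imR_evalMomenta (m : Fin u → ℤ) {b : Fin u}
    (f : MvPolynomial (GroupPair g b) ℝ) :
    poissonBracket (imR ε g m) (evalMomenta ε g f) = 0 := by
  ext y
  rw [poissonBracket_eq_fderiv_hamVec]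
  refine fderiv_imR_eq_zero ε g fun b' _ => ?_
  have hS : ∀ a : GroupPair g b, a.1.1 ∈ members g b' ↔ a.1.2 ∈ members g b' := fun a => by
    simp [a.2.1, a.2.2.1]
  rw [fderiv_groupW, fderiv_hamVec_swap, fderiv_hamVec_swap _ (evalMomenta ε g f),
    fderiv_hamVec_swap _ (evalMomenta ε g f),
    fderiv_evalMomenta_eq_zero ε g fun a => fderiv_momentum_hamVec_quadX ε (hS a) y,
    fderiv_evalMomenta_eq_zero ε g fun a => fderiv_momentum_hamVec_quadY ε (hS a) y,
    fderiv_evalMomenta_eq_zero ε g fun a => fderiv_momentum_hamVec_quadQ ε (hS a) y]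
  simp

/-- The two functions involve disjoint sets of oscillators: the Hamiltonian field of the second has
no component in the groups on which the first depends. -/
theorem poissonBracket_imR_imR {m m' : Fin u → ℤ} (h : ∀ b, m b * m' b = 0) :
    poissonBracket (imR ε g m) (imR ε g m') = 0 := by
  ext y
  rw [poissonBracket_eq_fderiv_hamVec]
  refine fderiv_imR_eq_zero ε g fun b hb => fderiv_groupW_eq_zero_of_support ε g fun k hk => ?_
  have hkb : ∀ b', m' b' ≠ 0 → g k ≠ b' := fun b' hb' hkb' => by
    have := h b
    rw [← hk, hkb'] at this
    rw [← hk, hkb'] at hb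
    exact (mul_ne_zero hb hb') this
  constructor
  · simp only [hamVec, neg_eq_zero]
    exact fderiv_imR_eq_zero ε g fun b' hb' => fderiv_groupW_eq_zero_of_support ε g
      fun i hi => (fderiv_single_ne g hi (hkb b' hb')).2
  · simp only [hamVec]
    exact fderiv_imR_eq_zero ε g fun b' hb' => fderiv_groupW_eq_zero_of_support ε g
      fun i hi => (fderiv_single_ne g hi (hkb b' hb')).1

theorem poissonBracket_evalMomenta_of_ne {b b' : Fin u} (hb : b ≠ b')
    (f : MvPolynomial (GroupPair g b) ℝ) (f' : MvPolynomial (GroupPair g b') ℝ) :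
    poissonBracket (evalMomenta ε g f) (evalMomenta ε g f') = 0 := by
  ext y
  rw [poissonBracket_eq_fderiv_hamVec]
  refine fderiv_evalMomenta_eq_zero_of_support ε g f fun k hk => ?_
  have hkb : g k ≠ b' := hk ▸ hb
  constructor
  · simp only [hamVec, neg_eq_zero]
    exact fderiv_evalMomenta_eq_zero_of_support ε g f' fun i hi => (fderiv_single_ne g hi hkb).2
  · simp only [hamVec]
    exact fderiv_evalMomenta_eq_zero_of_support ε g f' fun i hi => (fderiv_single_ne g hi hkb).1

theorem poissonBracket_eq_zero_symm {f f' : Phase n → ℝ} (h : poissonBracket f f' = 0) :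
    poissonBracket f' f = 0 := by
  ext y
  rw [poissonBracket_swap, h]
  simp

end Brackets

/-! ### Casimir polynomials -/

section Existence

variable {n u : ℕ} (ε : Fin n → ℤˣ) (g : Fin n → Fin u) (b : Fin u)

/-- The variable standing for the momentum `P_{ij}`, with `P_{ji} = -P_{ij}`. -/
noncomputable def momentumVar (i j : Fin n) : MvPolynomial (GroupPair g b) ℝ :=
  if h : g i = b ∧ g j = b ∧ i < j then MvPolynomial.X ⟨(i, j), h⟩
  else if h : g j = b ∧ g i = b ∧ j < i then -MvPolynomial.X ⟨(j, i), h⟩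
  else 0

/-- The Casimir polynomial `∑_{i < j} εᵢ εⱼ P_{ij}²` of the indices in `S`. -/
noncomputable def casimir (S : Finset (Fin n)) : MvPolynomial (GroupPair g b) ℝ :=
  ∑ i ∈ S, ∑ j ∈ S,
    MvPolynomial.C (((ε i : ℤ) : ℝ) * ((ε j : ℤ) : ℝ) / 2) * momentumVar g b i j ^ 2

theorem totalDegree_momentumVar_le (i j : Fin n) : (momentumVar g b i j).totalDegree ≤ 1 := by
  unfold momentumVar
  split_ifs <;> simp

theorem totalDegree_casimir_le (S : Finset (Fin n)) : (casimir ε g b S).totalDegree ≤ 2 := by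
  refine MvPolynomial.totalDegree_finsetSum_le fun i _ =>
    MvPolynomial.totalDegree_finsetSum_le fun j _ => ?_
  refine (MvPolynomial.totalDegree_mul _ _).trans ?_
  have h1 := MvPolynomial.totalDegree_pow (momentumVar g b i j) 2
  have h2 := totalDegree_momentumVar_le g b i j
  rw [MvPolynomial.totalDegree_C]
  omega

theorem evalMomenta_momentumVar {i j : Fin n} (hi : g i = b) (hj : g j = b) :
    evalMomenta ε g (momentumVar g b i j) = momentum ε i j := by
  ext y
  rcases lt_trichotomy i j with h | h | h
  · simp [evalMomenta, momentumVar, hi, hj, h]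
  · subst h
    simp [evalMomenta, momentumVar, momentum_eq]
  · simp only [evalMomenta, momentumVar, hi, hj, h, not_lt_of_gt h]
    simp [momentum_eq]

theorem evalMomenta_casimir_eq_sum {S : Finset (Fin n)} (hS : ∀ i ∈ S, g i = b) :
    evalMomenta ε g (casimir ε g b S) = fun y =>
      ∑ i ∈ S, ∑ j ∈ S, ((ε i : ℤ) : ℝ) * ((ε j : ℤ) : ℝ) / 2 * momentum ε i j y ^ 2 := by
  ext y
  simp only [evalMomenta, casimir, map_sum, map_mul, map_pow, MvPolynomial.eval_C]
  refine Finset.sum_congr rfl fun i hi => Finset.sum_congr rfl fun j hj => ?_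
  rw [← evalMomenta_momentumVar ε g b (hS i hi) (hS j hj)]
  rfl

/-- Lagrange's identity: the Gram determinant of `x` and `εp` is the signed sum of the squares of
their minors. -/
theorem evalMomenta_casimir {S : Finset (Fin n)} (hS : ∀ i ∈ S, g i = b) :
    evalMomenta ε g (casimir ε g b S) = fun y => quadX ε S y * quadY ε S y - quadQ S y ^ 2 := by
  ext y
  -- After symmetrizing `XY`, the two double sums agree term by term.
  have h : quadX ε S y * quadY ε S y - quadQ S y ^ 2 =
      (quadX ε S y * quadY ε S y + quadY ε S y * quadX ε S y) / 2 - quadQ S y * quadQ S y := by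
    ring
  rw [evalMomenta_casimir_eq_sum ε g b hS, h]
  simp only [quadX, quadY, quadQ, Finset.sum_mul_sum]
  simp only [← Finset.sum_add_distrib, Finset.sum_div, ← Finset.sum_sub_distrib]
  refine Finset.sum_congr rfl fun i _ => Finset.sum_congr rfl fun j _ => ?_
  rw [momentum_eq]
  have hi := coe_units_sq (ε i)
  have hj := coe_units_sq (ε j)
  generalize ((ε i : ℤ) : ℝ) = a at *
  generalize ((ε j : ℤ) : ℝ) = c at *
  linear_combination
    (a * c / 2 * (y.1 j * y.2 i) ^ 2 - y.1 i * y.2 j * (y.1 j * y.2 i) * c ^ 2) * hi +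
    (a * c / 2 * (y.1 i * y.2 j) ^ 2 - y.1 i * y.2 j * (y.1 j * y.2 i)) * hj

theorem fderiv_casimir {S : Finset (Fin n)} (hS : ∀ i ∈ S, g i = b) (y v : Phase n) :
    fderiv ℝ (evalMomenta ε g (casimir ε g b S)) y v =
      fderiv ℝ (quadX ε S) y v * quadY ε S y + quadX ε S y * fderiv ℝ (quadY ε S) y v -
        2 * quadQ S y * fderiv ℝ (quadQ S) y v := by
  have hX := ((contDiff_quadX ε S).differentiable (by simp) y).hasFDerivAt
  have hY := ((contDiff_quadY ε S).differentiable (by simp) y).hasFDerivAt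
  have hQ := ((contDiff_quadQ S).differentiable (by simp) y).hasFDerivAt
  have h : HasFDerivAt (fun y => quadX ε S y * quadY ε S y - quadQ S y ^ 2) _ y :=
    (hX.mul hY).sub (hQ.pow 2)
  rw [evalMomenta_casimir ε g b hS, h.fderiv]
  simp
  ring

theorem fderiv_casimir_eq_zero {S : Finset (Fin n)} (hS : ∀ i ∈ S, g i = b) {y v : Phase n}
    (h : ∀ i ∈ S, ∀ j ∈ S, fderiv ℝ (momentum ε i j) y v = 0) :
    fderiv ℝ (evalMomenta ε g (casimir ε g b S)) y v = 0 := by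
  have h2 : HasFDerivAt (fun y =>
      ∑ i ∈ S, ∑ j ∈ S, ((ε i : ℤ) : ℝ) * ((ε j : ℤ) : ℝ) / 2 * momentum ε i j y ^ 2) _ y :=
    HasFDerivAt.fun_sum fun i _ => HasFDerivAt.fun_sum fun j _ =>
      (((contDiff_momentum ε i j).differentiable (by simp) y).hasFDerivAt.pow 2).const_mul _
  rw [evalMomenta_casimir_eq_sum ε g b hS, h2.fderiv]
  simp only [sum_apply, smul_apply]
  refine Finset.sum_eq_zero fun i hi => Finset.sum_eq_zero fun j hj => ?_
  rw [h i hi j hj]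
  simp

/-- The Casimir is a function of `X_S`, `Y_S`, `Q_S`, each of which commutes with the momenta inside
`S`. -/
theorem fderiv_momentum_hamVec_casimir {S : Finset (Fin n)} (hS : ∀ i ∈ S, g i = b)
    {i j : Fin n} (hi : i ∈ S) (hj : j ∈ S) (y : Phase n) :
    fderiv ℝ (momentum ε i j) y (hamVec (evalMomenta ε g (casimir ε g b S)) y) = 0 := by
  have h : i ∈ S ↔ j ∈ S := iff_of_true hi hj
  rw [fderiv_hamVec_swap, fderiv_casimir ε g b hS, fderiv_hamVec_swap _ (momentum ε i j),
    fderiv_hamVec_swap _ (momentum ε i j), fderiv_hamVec_swap _ (momentum ε i j),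
    fderiv_momentum_hamVec_quadX ε h, fderiv_momentum_hamVec_quadY ε h,
    fderiv_momentum_hamVec_quadQ ε h]
  simp

theorem poissonBracket_casimir_momentum {S : Finset (Fin n)} (hS : ∀ i ∈ S, g i = b)
    {i j : Fin n} (hi : i ∈ S) (hj : j ∈ S) :
    poissonBracket (evalMomenta ε g (casimir ε g b S)) (momentum ε i j) = 0 := by
  apply poissonBracket_eq_zero_symm
  ext y
  rw [poissonBracket_eq_fderiv_hamVec, fderiv_momentum_hamVec_casimir ε g b hS hi hj]
  rfl

/-- The Casimir of `S` is a polynomial in momenta inside `T`, and the Casimir of `T` commutes with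
all of these. -/
theorem poissonBracket_casimir_casimir {S T : Finset (Fin n)} (hT : ∀ i ∈ T, g i = b)
    (hST : S ⊆ T) :
    poissonBracket (evalMomenta ε g (casimir ε g b S)) (evalMomenta ε g (casimir ε g b T)) = 0 := by
  ext y
  rw [poissonBracket_eq_fderiv_hamVec]
  exact fderiv_casimir_eq_zero ε g b (fun i hi => hT i (hST hi)) fun i hi j hj =>
    fderiv_momentum_hamVec_casimir ε g b hT (hST hi) (hST hj) y

end Existence

/-! ### Construction of the momentum systems -/

section MomentumSystem

variable {n u : ℕ} (ε : Fin n → ℤˣ) (g : Fin n → Fin u) (b : Fin u) {q : ℕ}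

/-- The first `k` elements of a list of oscillators. -/
def initialSet (e : Fin q ↪ Fin n) (k : ℕ) : Finset (Fin n) :=
  (Finset.univ.filter fun a : Fin q => (a : ℕ) < k).map e

theorem apply_mem_initialSet (e : Fin q ↪ Fin n) (k : ℕ) (a : Fin q) :
    e a ∈ initialSet e k ↔ (a : ℕ) < k := by
  simp [initialSet]

theorem initialSet_mono (e : Fin q ↪ Fin n) {k k' : ℕ} (h : k ≤ k') :
    initialSet e k ⊆ initialSet e k' := by
  intro i hi
  simp only [initialSet, Finset.mem_map, Finset.mem_filter_univ] at hi ⊢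
  obtain ⟨a, ha, rfl⟩ := hi
  exact ⟨a, ha.trans_le h, rfl⟩

theorem sum_initialSet (e : Fin q ↪ Fin n) (k : ℕ) (f : Fin n → ℝ) :
    ∑ i ∈ initialSet e k, f i = ∑ a : Fin q, if (a : ℕ) < k then f (e a) else 0 := by
  rw [initialSet, Finset.sum_map, Finset.sum_filter]

/-- The point at which the momentum system `(C_t, …, C_q; P_{0j}, P_{1j})` is shown to be
functionally independent. -/
noncomputable def testPoint (e : Fin q ↪ Fin n) (t : ℕ) : Phase n :=
  (fun i => if ∃ a, e a = i ∧ (a : ℕ) = 0 then 1 else 0,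
    fun i => if ∃ a, e a = i ∧ ((a : ℕ) = 1 ∨ t ≤ (a : ℕ)) then ((ε i : ℤ) : ℝ) else 0)

theorem testPoint_fst (e : Fin q ↪ Fin n) (t : ℕ) (a : Fin q) :
    (testPoint ε e t).1 (e a) = if (a : ℕ) = 0 then 1 else 0 := by
  simp [testPoint]

theorem testPoint_snd (e : Fin q ↪ Fin n) (t : ℕ) (a : Fin q) :
    (testPoint ε e t).2 (e a) =
      if (a : ℕ) = 1 ∨ t ≤ (a : ℕ) then ((ε (e a) : ℤ) : ℝ) else 0 := by
  simp [testPoint]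

variable {g b}

theorem quadQ_testPoint (e : Fin q ↪ Fin n) {t : ℕ} (ht : 2 ≤ t) (k : ℕ) :
    quadQ (initialSet e k) (testPoint ε e t) = 0 := by
  rw [quadQ, sum_initialSet]
  refine Finset.sum_eq_zero fun a _ => ?_
  rw [testPoint_fst, testPoint_snd]
  split_ifs <;> first | omega | simp

theorem quadX_testPoint (e : Fin q ↪ Fin n) (t : ℕ) {k : ℕ} (hk : 0 < k) (a₀ : Fin q)
    (h₀ : (a₀ : ℕ) = 0) :
    quadX ε (initialSet e k) (testPoint ε e t) = ((ε (e a₀) : ℤ) : ℝ) := by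
  rw [quadX, sum_initialSet, Finset.sum_eq_single a₀]
  · simp [testPoint_fst, h₀, hk]
  · intro a _ ha
    have : (a : ℕ) ≠ 0 := fun h => ha (Fin.ext (h.trans h₀.symm))
    simp [testPoint_fst, this]
  · simp

theorem quadY_testPoint (e : Fin q ↪ Fin n) {t : ℕ} (ht : 2 ≤ t) (a₁ : Fin q)
    (h₁ : (a₁ : ℕ) = 1) :
    quadY ε (initialSet e t) (testPoint ε e t) = ((ε (e a₁) : ℤ) : ℝ) := by
  rw [quadY, sum_initialSet, Finset.sum_eq_single a₁]
  · have h : 1 < t := ht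
    simp only [testPoint_snd, h₁, h, true_or, if_true]
    linear_combination ((ε (e a₁) : ℤ) : ℝ) * coe_units_sq (ε (e a₁))
  · intro a _ ha
    have h : (a : ℕ) ≠ 1 := fun h => ha (Fin.ext (h.trans h₁.symm))
    simp only [testPoint_snd]
    split_ifs <;> first | omega | simp
  · simp

theorem fderiv_casimir_testPoint_snd (e : Fin q ↪ Fin n) (he : ∀ a, g (e a) = b) {t : ℕ}
    (ht : 2 ≤ t) {k : ℕ} (hk : 0 < k) (a₀ : Fin q) (h₀ : (a₀ : ℕ) = 0) (a : Fin q) :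
    fderiv ℝ (evalMomenta ε g (casimir ε g b (initialSet e k))) (testPoint ε e t)
      (0, Pi.single (e a) 1) =
      if (a : ℕ) < k then
        2 * ((ε (e a₀) : ℤ) : ℝ) * ((ε (e a) : ℤ) : ℝ) * (testPoint ε e t).2 (e a) else 0 := by
  have hS : ∀ i ∈ initialSet e k, g i = b := by
    intro i hi
    simp only [initialSet, Finset.mem_map] at hi
    obtain ⟨a, -, rfl⟩ := hi
    exact he a
  rw [fderiv_casimir ε g b hS, quadQ_testPoint ε e ht, quadX_testPoint ε e t hk a₀ h₀,
    fderiv_quadX, fderiv_quadY]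
  simp only [Pi.single_apply, apply_mem_initialSet, mul_ite, mul_one, mul_zero,
    Finset.sum_ite_eq', Pi.zero_apply, Finset.sum_const_zero]
  split_ifs <;> ring

theorem fderiv_casimir_testPoint_fst (e : Fin q ↪ Fin n) (he : ∀ a, g (e a) = b) {t : ℕ}
    (ht : 2 ≤ t) (a₀ a₁ : Fin q) (h₀ : (a₀ : ℕ) = 0) (h₁ : (a₁ : ℕ) = 1) :
    fderiv ℝ (evalMomenta ε g (casimir ε g b (initialSet e t))) (testPoint ε e t)
      (Pi.single (e a₀) 1, 0) = 2 * ((ε (e a₀) : ℤ) : ℝ) * ((ε (e a₁) : ℤ) : ℝ) := by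
  have hS : ∀ i ∈ initialSet e t, g i = b := by
    intro i hi
    simp only [initialSet, Finset.mem_map] at hi
    obtain ⟨a, -, rfl⟩ := hi
    exact he a
  have h : 0 < t := by omega
  rw [fderiv_casimir ε g b hS, quadQ_testPoint ε e ht, quadY_testPoint ε e ht a₁ h₁,
    fderiv_quadX, fderiv_quadY]
  simp only [Pi.single_apply, apply_mem_initialSet, mul_ite, mul_one, mul_zero, h,
    Finset.sum_ite_eq', Pi.zero_apply, Finset.sum_const_zero, testPoint_fst, h₀, if_true]
  ring

/-- The functions `P_{0j}` and `P_{1j}` for `2 ≤ j < t`. -/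
noncomputable def lowMomentum (e : Fin q ↪ Fin n) (w : ℕ) (hw : w + 2 ≤ q)
    (p : Fin 2 × Fin w) : Phase n → ℝ :=
  momentum ε (e ⟨p.1, by omega⟩) (e ⟨p.2 + 2, by omega⟩)

theorem fderiv_lowMomentum_testPoint_snd (e : Fin q ↪ Fin n) {w : ℕ} (hw : w + 2 ≤ q)
    (p : Fin 2 × Fin w) (a : Fin q) (ha : 2 ≤ (a : ℕ)) :
    fderiv ℝ (lowMomentum ε e w hw p) (testPoint ε e (w + 2)) (0, Pi.single (e a) 1) =
      if (p.1 : ℕ) = 0 ∧ (p.2 : ℕ) + 2 = a then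
        ((ε (e ⟨p.2 + 2, by omega⟩) : ℤ) : ℝ) else 0 := by
  have h1 : (p.1 : ℕ) ≠ a := by omega
  rw [lowMomentum, fderiv_momentum]
  simp only [testPoint_fst, Pi.single_apply, e.injective.eq_iff, Fin.ext_iff, Pi.zero_apply, h1]
  split_ifs <;> simp <;> omega

theorem fderiv_lowMomentum_testPoint_fst (e : Fin q ↪ Fin n) {w : ℕ} (hw : w + 2 ≤ q)
    (p : Fin 2 × Fin w) (a : Fin q) :
    fderiv ℝ (lowMomentum ε e w hw p) (testPoint ε e (w + 2)) (Pi.single (e a) 1, 0) =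
      if (p.1 : ℕ) = 1 ∧ (p.2 : ℕ) + 2 = a then -1 else 0 := by
  have h2 : ¬ ((p.2 : ℕ) + 2 = 1 ∨ w + 2 ≤ (p.2 : ℕ) + 2) := by omega
  have h3 : ((p.1 : ℕ) = 1 ∨ w + 2 ≤ (p.1 : ℕ)) ↔ (p.1 : ℕ) = 1 := by omega
  rw [lowMomentum, fderiv_momentum]
  simp only [testPoint_snd, Pi.single_apply, e.injective.eq_iff, Fin.ext_iff, Pi.zero_apply, h2, h3]
  by_cases hp : (p.1 : ℕ) = 1 <;> by_cases hp2 : (p.2 : ℕ) + 2 = a <;> simp [hp, hp2]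
  rw [← sq]
  exact coe_units_sq _

/-- At the test point, on the listed oscillators, `x` lives on index 0 only and `εp` is 1 at index 1
and at the indices `≥ w + 2`. Every `Q` of an initial set vanishes there, and along suitable
coordinate directions the matrix of differentials is triangular. -/
theorem linearIndependent_momentumSystem (e : Fin q ↪ Fin n) (he : ∀ a, g (e a) = b) {w z : ℕ}
    (hz : 1 ≤ z) (hw : w + z + 1 = q) :
    LinearIndependent ℝ fun i => fderiv ℝ (Sum.elim
      (fun i : Fin z => evalMomenta ε g (casimir ε g b (initialSet e (w + 2 + i))))
      (lowMomentum ε e w (by omega)) i) (testPoint ε e (w + 2)) := by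
  rw [Fintype.linearIndependent_iff]
  intro c hc
  let a₀ : Fin q := ⟨0, by omega⟩
  let a₁ : Fin q := ⟨1, by omega⟩
  have key : ∀ v, ∑ i : Fin z, c (Sum.inl i) * fderiv ℝ
        (evalMomenta ε g (casimir ε g b (initialSet e (w + 2 + i)))) (testPoint ε e (w + 2)) v +
      ∑ p, c (Sum.inr p) *
        fderiv ℝ (lowMomentum ε e w (by omega) p) (testPoint ε e (w + 2)) v = 0 := by
    intro v
    simpa [Fintype.sum_sum_type] using DFunLike.congr_fun hc v
  have hne : ∀ a, ((ε (e a) : ℤ) : ℝ) ≠ 0 := fun a => coe_units_ne_zero _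
  -- Descending induction on `i`. The direction is the `p` of the last oscillator of the `i`-th set:
  -- smaller sets do not contain it, and the coefficients of larger ones are already zero. For `i =
  -- 0` its index would be `w + 1`, below the range `≥ w + 2`.
  have step1 : ∀ d : ℕ, ∀ i : Fin z, z - i = d → 0 < (i : ℕ) → c (Sum.inl i) = 0 := by
    intro d
    induction d using Nat.strong_induction_on with
    | _ d ih =>
      intro i hd hi
      let a : Fin q := ⟨w + 1 + i, by omega⟩
      have ha : (a : ℕ) = w + 1 + i := rfl
      have h := key (0, Pi.single (e a) 1)
      rw [Finset.sum_eq_single i, Finset.sum_eq_zero, fderiv_casimir_testPoint_snd ε e he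
        (by omega) (by omega) a₀ rfl, if_pos (by omega), testPoint_snd, if_pos (by omega)] at h
      · simpa [hne] using h
      · intro p _
        rw [fderiv_lowMomentum_testPoint_snd _ _ _ _ _ (by omega), if_neg (by omega), mul_zero]
      · intro i' _ hne'
        rcases lt_or_gt_of_ne hne' with hlt | hlt
        · have : (i' : ℕ) < i := hlt
          rw [fderiv_casimir_testPoint_snd ε e he (by omega) (by omega) a₀ rfl,
            if_neg (by omega), mul_zero]
        · have : (i : ℕ) < i' := hlt
          rw [ih (z - i') (by omega) i' rfl (by omega), zero_mul]
      · simp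
  have step2 : ∀ i : Fin z, c (Sum.inl i) = 0 := by
    intro i
    by_cases hi : 0 < (i : ℕ)
    · exact step1 _ i rfl hi
    -- The smallest Casimir is detected along `x₀`, where its derivative is `2 x₀ ε₀ Y = 2 ε₀ ε₁`;
    -- the momenta `P_{0j}`, `P_{1j}` do not see this direction because `pⱼ = 0` for `2 ≤ j < w +
    -- 2`.
    · have h := key (Pi.single (e a₀) 1, 0)
      have hi0 : (i : ℕ) = 0 := by omega
      rw [Finset.sum_eq_single i, Finset.sum_eq_zero, hi0, add_zero,
        fderiv_casimir_testPoint_fst ε e he (by omega) a₀ a₁ rfl rfl] at h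
      · simpa [hne] using h
      · intro p _
        rw [fderiv_lowMomentum_testPoint_fst,
          if_neg (by simp [a₀]), mul_zero]
      · intro i' _ hne'
        have : (i' : ℕ) ≠ i := fun h => hne' (Fin.ext h)
        rw [step1 _ i' rfl (by omega), zero_mul]
      · simp
  rintro (i | ⟨s, j⟩)
  · exact step2 i
  simp only [step2, zero_mul, Finset.sum_const_zero, zero_add] at key
  let a : Fin q := ⟨j + 2, by omega⟩
  have ha : (a : ℕ) = j + 2 := rfl
  -- `P_{0j}` is singled out by the direction `pⱼ` since `x₀ = 1`, and `P_{1j}` by the direction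
  -- `xⱼ` since `ε₁ p₁ = 1`.
  have hs : (s : ℕ) = 0 ∨ (s : ℕ) = 1 := by omega
  rcases hs with hs | hs
  · have h := key (0, Pi.single (e a) 1)
    rw [Finset.sum_eq_single (s, j), fderiv_lowMomentum_testPoint_snd _ _ _ _ _ (by omega),
      if_pos ⟨hs, rfl⟩] at h
    · simpa [hne] using h
    · rintro ⟨s', j'⟩ _ hne'
      rw [fderiv_lowMomentum_testPoint_snd _ _ _ _ _ (by omega), if_neg, mul_zero]
      rintro ⟨h1, h2⟩
      exact hne' (Prod.ext (Fin.ext (h1.trans hs.symm)) (Fin.ext (by simpa [ha] using h2)))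
    · simp
  · have h := key (Pi.single (e a) 1, 0)
    rw [Finset.sum_eq_single (s, j), fderiv_lowMomentum_testPoint_fst,
      if_pos ⟨hs, rfl⟩] at h
    · simpa using h
    · rintro ⟨s', j'⟩ _ hne'
      rw [fderiv_lowMomentum_testPoint_fst, if_neg, mul_zero]
      rintro ⟨h1, h2⟩
      exact hne' (Prod.ext (Fin.ext (h1.trans hs.symm)) (Fin.ext (by simpa [ha] using h2)))
    · simp

variable (g b)

/-- Nested Casimirs commute with each other, and both indices of each chosen momentum lie in the
smallest set, hence in all of them. -/
theorem exists_isMomentumSystem {z : ℕ} (hz1 : groupSize g b = 1 → z = 0)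
    (hz2 : 1 < groupSize g b → 1 ≤ z ∧ z ≤ groupSize g b - 1) (hq : 0 < groupSize g b) :
    ∃ (Z : Fin z → MvPolynomial (GroupPair g b) ℝ)
      (L : Fin (2 * (groupSize g b - z - 1)) → MvPolynomial (GroupPair g b) ℝ),
      IsMomentumSystem ε g b z Z L := by
  by_cases hq1 : groupSize g b = 1
  · obtain rfl := hz1 hq1
    have : IsEmpty (Fin (2 * (groupSize g b - 0 - 1))) := by
      rw [show 2 * (groupSize g b - 0 - 1) = 0 by omega]
      infer_instance
    exact ⟨isEmptyElim, isEmptyElim, isEmptyElim, isEmptyElim,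
      ⟨Set.univ, isOpen_univ, dense_univ, fun _ _ => linearIndependent_empty_type⟩,
      isEmptyElim, isEmptyElim⟩
  obtain ⟨hz, hzq⟩ := hz2 (by omega)
  have hwq : groupSize g b - z - 1 + z + 1 = groupSize g b := by omega
  let e : Fin (groupSize g b) ↪ Fin n := ((members g b).orderEmbOfFin rfl).toEmbedding
  have he : ∀ a, g (e a) = b := fun a => by
    exact (Finset.mem_filter.1 ((members g b).orderEmbOfFin_mem rfl a)).2
  have hS : ∀ k, ∀ i ∈ initialSet e k, g i = b := by
    intro k i hi
    simp only [initialSet, Finset.mem_map] at hi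
    obtain ⟨a, -, rfl⟩ := hi
    exact he a
  let L' : Fin 2 × Fin (groupSize g b - z - 1) → MvPolynomial (GroupPair g b) ℝ := fun p =>
    momentumVar g b (e ⟨p.1, by omega⟩) (e ⟨p.2 + 2, by omega⟩)
  have hL' : ∀ p, evalMomenta ε g (L' p) = lowMomentum ε e _ (by omega) p := fun p =>
    evalMomenta_momentumVar ε g b (he _) (he _)
  refine ⟨fun i => casimir ε g b (initialSet e (groupSize g b - z - 1 + 2 + i)),
    fun j => L' (finProdFinEquiv.symm j),
    fun i => totalDegree_casimir_le _ _ _ _,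
    fun j => (totalDegree_momentumVar_le _ _ _ _).trans one_le_two, ?_, ?_, ?_⟩
  · refine functionallyIndependent_of_point ?_ (testPoint ε e (groupSize g b - z - 1 + 2)) ?_
    · rintro (i | j)
      · exact contDiff_evalMomenta ε g _
      · exact contDiff_evalMomenta ε g _
    · have h := (linearIndependent_momentumSystem ε e he hz hwq).comp
        (Sum.map id (finProdFinEquiv (m := 2) (n := groupSize g b - z - 1)).symm)
        (Function.injective_id.sumMap (Equiv.injective _))
      convert h using 2 with i
      rcases i with i | j
      · rfl
      · simp [hL']
  · intro i j
    rcases le_total (i : ℕ) j with h | h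
    · exact poissonBracket_casimir_casimir ε g b (hS _) (initialSet_mono e (by omega))
    · exact poissonBracket_eq_zero_symm
        (poissonBracket_casimir_casimir ε g b (hS _) (initialSet_mono e (by omega)))
  · intro i j
    rw [hL', lowMomentum]
    exact poissonBracket_casimir_momentum ε g b (hS _)
      ((apply_mem_initialSet _ _ _).2 (by dsimp only; omega))
      ((apply_mem_initialSet _ _ _).2 (by dsimp only; omega))

end MomentumSystem

/-! ### Functional independence of the whole family -/

section Independence

variable {n u : ℕ} (ε : Fin n → ℤˣ) (g : Fin n → Fin u)

/-- A point at which every `W_b` is `1` or `-1`. -/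
theorem exists_groupW_eq_units (hg : Function.Surjective g) :
    ∃ y : Phase n, ∀ b, ∃ e : ℤˣ, groupW ε g b y = ((e : ℤ) : ℂ) := by
  obtain ⟨i, hi⟩ := hg.hasRightInverse
  -- One oscillator per group is excited, with `x = √2` so that `ε x²/2 = ε`.
  refine ⟨(fun k => if i (g k) = k then Real.sqrt 2 else 0, 0), fun b => ⟨ε (i b), ?_⟩⟩
  have hX : quadX ε (members g b) (fun k => if i (g k) = k then Real.sqrt 2 else 0, 0) =
      2 * ((ε (i b) : ℤ) : ℝ) := by
    rw [quadX, Finset.sum_eq_single (i b)]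
    · simp [hi b, mul_comm]
    · intro k hk hne
      have hk' : g k = b := by simpa using hk
      simp [hk', hne.symm]
    · simp [hi b]
  rw [groupW_eq, hX]
  simp [quadY, quadQ]

theorem dense_groupW_re_ne_zero (hg : Function.Surjective g) (b : Fin u) :
    Dense {y : Phase n | (groupW ε g b y).re ≠ 0} := by
  obtain ⟨y₀, hy₀⟩ := exists_groupW_eq_units ε g hg
  refine dense_ne_zero_of_contDiff (y₀ := y₀)
    (Complex.reCLM.contDiff.comp (contDiff_groupW ε g b)) ?_
  obtain ⟨e, he⟩ := hy₀ b
  simp [he]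

theorem dense_R_re_ne_zero (hg : Function.Surjective g) (m : Fin u → ℤ) :
    Dense {y : Phase n | (R ε g m y).re ≠ 0} := by
  obtain ⟨y₀, hy₀⟩ := exists_groupW_eq_units ε g hg
  refine dense_ne_zero_of_contDiff (y₀ := y₀)
    (Complex.reCLM.contDiff.comp (contDiff_R ε g m)) ?_
  choose e he using hy₀
  have : R ε g m y₀ = (((∏ b, if 0 ≤ m b then e b ^ (m b).toNat else e b ^ (-m b).toNat : ℤˣ)
      : ℤ) : ℂ) := by
    rw [R, Units.coe_prod, Int.cast_prod]
    refine Finset.prod_congr rfl fun b _ => ?_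
    split_ifs <;> simp [he]
  change (R ε g m y₀).re ≠ 0
  rw [this, Complex.intCast_re]
  exact coe_units_ne_zero _

theorem isOpen_re_ne_zero {f : Phase n → ℂ} (hf : ContDiff ℝ ω f) : IsOpen {y | (f y).re ≠ 0} :=
  isOpen_ne_fun (Complex.continuous_re.comp hf.continuous) continuous_const

/-- The part of a vector supported in a group. -/
noncomputable def groupPart (b : Fin u) (v : Phase n) : Phase n :=
  (fun i => if g i = b then v.1 i else 0, fun i => if g i = b then v.2 i else 0)

theorem fderiv_evalMomenta_groupPart {b : Fin u} (f : MvPolynomial (GroupPair g b) ℝ)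
    (y v : Phase n) :
    fderiv ℝ (evalMomenta ε g f) y (groupPart g b v) = fderiv ℝ (evalMomenta ε g f) y v := by
  rw [← sub_eq_zero, ← map_sub]
  exact fderiv_evalMomenta_eq_zero_of_support ε g f fun i hi => by simp [groupPart, hi]

theorem fderiv_evalMomenta_groupPart_ne {b b' : Fin u} (hb : b ≠ b')
    (f : MvPolynomial (GroupPair g b) ℝ) (y v : Phase n) :
    fderiv ℝ (evalMomenta ε g f) y (groupPart g b' v) = 0 :=
  fderiv_evalMomenta_eq_zero_of_support ε g f fun i hi => by simp [groupPart, hi, hb]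

theorem linearIndependent_intCast {ι : Type*} {m : ι → Fin u → ℤ} (hm : LinearIndependent ℤ m) :
    LinearIndependent ℝ fun i b => ((m i b : ℤ) : ℝ) :=
  (linearIndependent_algebraMap_comp_iff (R := ℤ) (S := ℝ)).2 hm

/-- Functions of the momenta of the single groups, together with the `J_r` and the `Im R_m`, are
functionally independent if this holds group by group, and the vectors `r` and the vectors `m`
are linearly independent. -/
theorem functionallyIndependent_J_imR_evalMomenta {ρ μ : Type*} [Fintype ρ] [Fintype μ]
    {κ : Fin u → Type*} [∀ b, Fintype (κ b)] (hg : Function.Surjective g)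
    {r : ρ → Fin u → ℤ} (hr : LinearIndependent ℤ r) {m : μ → Fin u → ℤ}
    (hm : LinearIndependent ℤ m) (f : ∀ b, κ b → MvPolynomial (GroupPair g b) ℝ)
    (hf : ∀ b, FunctionallyIndependent fun i => evalMomenta ε g (f b i)) :
    FunctionallyIndependent (Sum.elim (Sum.elim (fun i => J ε g (r i)) fun i => imR ε g (m i))
      fun a : (b : Fin u) × κ b => evalMomenta ε g (f a.1 a.2)) := by
  choose U hUo hUd hU using hf
  refine ⟨((⋂ b, U b) ∩ ⋂ b, {y | (groupW ε g b y).re ≠ 0}) ∩ ⋂ i, {y | (R ε g (m i) y).re ≠ 0},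
    ?_, ?_, ?_⟩
  · exact ((isOpen_iInter_of_finite hUo).inter
      (isOpen_iInter_of_finite fun b => isOpen_re_ne_zero (contDiff_groupW ε g b))).inter
      (isOpen_iInter_of_finite fun i => isOpen_re_ne_zero (contDiff_R ε g (m i)))
  · have hd1 := dense_iInter_of_isOpen hUo hUd
    have hd2 := dense_iInter_of_isOpen (fun b => isOpen_re_ne_zero (contDiff_groupW ε g b))
      (dense_groupW_re_ne_zero ε g hg)
    have hd3 := dense_iInter_of_isOpen (fun i => isOpen_re_ne_zero (contDiff_R ε g (m i)))
      (fun i => dense_R_re_ne_zero ε g hg (m i))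
    have hd := hd1.inter_of_isOpen_right hd2
      (isOpen_iInter_of_finite fun b => isOpen_re_ne_zero (contDiff_groupW ε g b))
    exact hd.inter_of_isOpen_right hd3
      (isOpen_iInter_of_finite fun i => isOpen_re_ne_zero (contDiff_R ε g (m i)))
  rintro y ⟨⟨hyU, hyW⟩, hyR⟩
  simp only [Set.mem_iInter, Set.mem_ofPred_eq] at hyU hyW hyR
  rw [Fintype.linearIndependent_iff]
  intro c hc
  have key : ∀ v, ∑ i, c (Sum.inl (Sum.inl i)) * fderiv ℝ (J ε g (r i)) y v +
      ∑ i, c (Sum.inl (Sum.inr i)) * fderiv ℝ (imR ε g (m i)) y v +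
      ∑ a : (b : Fin u) × κ b, c (Sum.inr a) * fderiv ℝ (evalMomenta ε g (f a.1 a.2)) y v = 0 := by
    intro v
    simpa [Fintype.sum_sum_type] using DFunLike.congr_fun hc v
  have hmem : ∀ {b : Fin u} (a : GroupPair g b) (b' : Fin u),
      a.1.1 ∈ members g b' ↔ a.1.2 ∈ members g b' := fun a b' => by simp [a.2.1, a.2.2.1]
  -- The field of `K_b` annihilates the `J_r` and the momenta; letting `b` vary gives a relation
  -- between the vectors `m i`.
  have hcm : ∀ i, c (Sum.inl (Sum.inr i)) = 0 := by
    have h0 : ∀ i, c (Sum.inl (Sum.inr i)) * (2 * (R ε g (m i) y).re) = 0 := by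
      refine Fintype.linearIndependent_iff.1 (linearIndependent_intCast hm) _ ?_
      ext b
      have h := key (hamVec (groupAction ε g b) y)
      have h1 : ∀ i, fderiv ℝ (imR ε g (m i)) y (hamVec (groupAction ε g b) y) =
          2 * (m i b : ℝ) * (R ε g (m i) y).re := fun i => by
        rw [fderiv_imR ε g (fun b' => if b' = b then 1 else 0) fun b' _ => ?_]
        · simp
        · rw [fderiv_groupW_hamVec_groupAction]
          split_ifs <;> simp
      have h2 : ∀ i, fderiv ℝ (J ε g (r i)) y (hamVec (groupAction ε g b) y) = 0 := fun i => by
        simp [fderiv_J, fderiv_groupAction_hamVec_groupAction]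
      have h3 : ∀ a : (b : Fin u) × κ b,
          fderiv ℝ (evalMomenta ε g (f a.1 a.2)) y (hamVec (groupAction ε g b) y) = 0 := fun a =>
        fderiv_evalMomenta_eq_zero ε g fun p =>
          fderiv_momentum_hamVec_groupAction ε g (p.2.1.trans p.2.2.1.symm) b y
      simp only [h1, h2, h3, mul_zero, Finset.sum_const_zero, zero_add, add_zero] at h
      simp only [Finset.sum_apply, Pi.smul_apply, smul_eq_mul, Pi.zero_apply]
      rw [← h]
      exact Finset.sum_congr rfl fun i _ => by ring
    intro i
    simpa [hyR i] using h0 i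
  -- The field of `Q_b` annihilates the momenta, and the `Im R_m` have already dropped out. Dividing
  -- by `-2 Re W_b` leaves a relation between the vectors `r i`.
  have hcr : ∀ i, c (Sum.inl (Sum.inl i)) = 0 := by
    refine Fintype.linearIndependent_iff.1 (linearIndependent_intCast hr) _ ?_
    ext b
    have h := key (hamVec (quadQ (members g b)) y)
    have h2 : ∀ i, fderiv ℝ (J ε g (r i)) y (hamVec (quadQ (members g b)) y) =
        r i b * (-2 * (groupW ε g b y).re) := fun i => by
      simp only [fderiv_J, fderiv_groupAction_hamVec_quadQ, groupW_re]
      simp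
      ring
    have h3 : ∀ a : (b : Fin u) × κ b,
        fderiv ℝ (evalMomenta ε g (f a.1 a.2)) y (hamVec (quadQ (members g b)) y) = 0 := fun a =>
      fderiv_evalMomenta_eq_zero ε g fun p => fderiv_momentum_hamVec_quadQ ε (hmem p b) y
    simp only [hcm, h2, h3, zero_mul, mul_zero, Finset.sum_const_zero, add_zero, ← mul_assoc,
      ← Finset.sum_mul] at h
    simp only [Finset.sum_apply, Pi.smul_apply, smul_eq_mul, Pi.zero_apply]
    simpa [hyW b] using h
  -- Only momenta remain, and vectors supported in one group separate the groups.
  have hcf : ∀ b i, c (Sum.inr ⟨b, i⟩) = 0 := by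
    intro b
    refine Fintype.linearIndependent_iff.1 (hU b y (hyU b)) _ ?_
    refine ContinuousLinearMap.ext fun v => ?_
    have h := key (groupPart g b v)
    simp only [hcm, hcr, zero_mul, Finset.sum_const_zero, zero_add, Fintype.sum_sigma] at h
    rw [Finset.sum_eq_single b] at h
    · simp only [fderiv_evalMomenta_groupPart] at h
      simpa using h
    · intro b' _ hb'
      exact Finset.sum_eq_zero fun i _ => by
        rw [fderiv_evalMomenta_groupPart_ne ε g hb', mul_zero]
    · simp
  rintro ((i | i) | ⟨b, i⟩)
  exacts [hcr i, hcm i, hcf b i]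

end Independence

/-! ### Counting, and the hamiltonian as `J_s` -/

section Main

variable {n u : ℕ}

theorem FunctionallyIndependent.comp {ι κ : Type*} {F : ι → Phase n → ℝ}
    (hF : FunctionallyIndependent F) (φ : κ → ι) (hφ : Function.Injective φ) :
    FunctionallyIndependent (F ∘ φ) := by
  obtain ⟨U, hU, hd, h⟩ := hF
  exact ⟨U, hU, hd, fun y hy => (h y hy).comp φ hφ⟩

theorem sum_groupSize (g : Fin n → Fin u) : ∑ b, groupSize g b = n := by
  simpa [groupSize] using
    (Finset.card_eq_sum_card_fiberwise (f := g) (s := Finset.univ) (t := Finset.univ)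
      (by simp)).symm

theorem groupSize_pos {g : Fin n → Fin u} (hg : Function.Surjective g) (b : Fin u) :
    0 < groupSize g b := by
  obtain ⟨i, hi⟩ := hg b
  exact Finset.card_pos.2 ⟨i, by simpa using hi⟩

theorem J_eq_hamiltonian {l : Fin n → ℤ} {ε : Fin n → ℤˣ} {s : Fin u → ℕ} {g : Fin n → Fin u}
    (hl : ∀ i, l i = (ε i : ℤ) * (s (g i) : ℤ)) :
    J ε g (fun b => (s b : ℤ)) = hamiltonian l := by
  ext y
  rw [hamiltonian, ← Finset.sum_fiberwise (s := Finset.univ) (g := g)]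
  refine Finset.sum_congr rfl fun b _ => ?_
  rw [groupAction, Finset.mul_sum]
  refine Finset.sum_congr rfl fun i hi => ?_
  rw [hl, (Finset.mem_filter.1 hi).2]
  push_cast
  ring

theorem card_fin_lt {N k : ℕ} (h : k ≤ N) : Fintype.card {i : Fin N // (i : ℕ) < k} = k := by
  rw [Fintype.card_congr (Fin.castLEquiv h).symm, Fintype.card_fin]

theorem card_fin_ge {N k : ℕ} (h : k ≤ N) : Fintype.card {i : Fin N // k ≤ (i : ℕ)} = N - k := by
  have h1 := Fintype.card_subtype_compl fun i : Fin N => (i : ℕ) < k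
  rw [card_fin_lt h, Fintype.card_fin] at h1
  rw [← h1]
  exact Fintype.card_congr (Equiv.subtypeEquivRight fun i => not_lt.symm)

end Main
end ResonantOscillators

/-! ### The integrable set -/

open ResonantOscillators
theorem mainTheorem2 {n u : ℕ}
    -- frequencies `l i = ε i * s (g i)`, where `g i` is the group of the `i`-th oscillator
    (l : Fin n → ℤ) (ε : Fin n → ℤˣ) (s : Fin u → ℕ) (g : Fin n → Fin u)
    (hg : Function.Surjective g) (hs : ∀ b, 0 < s b)
    (hl : ∀ i, l i = (ε i : ℤ) * (s (g i) : ℤ))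
    -- the numbers `z_b` of elements of the sets `Z` of the various groups
    (z : Fin u → ℕ) (hz1 : ∀ b, groupSize g b = 1 → z b = 0)
    (hz2 : ∀ b, 1 < groupSize g b → 1 ≤ z b ∧ z b ≤ groupSize g b - 1)
    -- the vectors `m`, the first `k'` of which have supports disjoint from all the others
    (k' h : ℕ) (hk1 : 1 ≤ k') (hk2 : 2 * k' ≤ u) (hkh : k' ≤ h)
    (m : Fin h → Fin u → ℤ) (hm : LinearIndependent ℤ m)
    (hms : ∀ i, ∑ b, m i b * (s b : ℤ) = 0)
    (hmm : ∀ i j : Fin h, (j : ℕ) < k' → i ≠ j → ∀ b, m i b * m j b = 0)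
    -- the vectors `r`
    (r : Fin (u - k') → Fin u → ℤ) (hr : LinearIndependent ℤ r)
    (hr1 : ∀ i : Fin (u - k'), (i : ℕ) = 0 → r i = fun b => (s b : ℤ))
    (hrm1 : ∀ (i : Fin (u - k')) (j : Fin h), (j : ℕ) < k' → ∑ b, r i b * m j b = 0)
    (hrm2 : ∀ (i : Fin (u - k')) (j : Fin h), (i : ℕ) < u - h → k' ≤ (j : ℕ) →
      ∑ b, r i b * m j b = 0) :
    -- sets `Z`, `L` of the required kind exist for every group
    (∀ b, ∃ (Z : Fin (z b) → MvPolynomial (GroupPair g b) ℝ)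
        (L : Fin (2 * (groupSize g b - z b - 1)) → MvPolynomial (GroupPair g b) ℝ),
        IsMomentumSystem ε g b (z b) Z L) ∧
    -- the first of the functions `J` is the hamiltonian
    (∀ i : Fin (u - k'), (i : ℕ) = 0 → J ε g (r i) = hamiltonian l) ∧
    -- for every choice of `Z`, `L` the set `(J₁, R₁, Z; J₂, R₂, L)` is integrable
    ∀ (Z : ∀ b, Fin (z b) → MvPolynomial (GroupPair g b) ℝ)
      (L : ∀ b, Fin (2 * (groupSize g b - z b - 1)) → MvPolynomial (GroupPair g b) ℝ),
      (∀ b, IsMomentumSystem ε g b (z b) (Z b) (L b)) →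
      IsIntegrableSet (u - h + k' + ∑ b, z b)
        (Sum.elim
          (Sum.elim
            (fun i : {i : Fin (u - k') // (i : ℕ) < u - h} => J ε g (r i.1))
            (fun i : {i : Fin h // (i : ℕ) < k'} => imR ε g (m i.1)))
          (fun a : (b : Fin u) × Fin (z b) => evalMomenta ε g (Z a.1 a.2)))
        (Sum.elim
          (Sum.elim
            (fun i : {i : Fin (u - k') // u - h ≤ (i : ℕ)} => J ε g (r i.1))
            (fun i : {i : Fin h // k' ≤ (i : ℕ)} => imR ε g (m i.1)))
          (fun a : (b : Fin u) × Fin (2 * (groupSize g b - z b - 1)) =>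
            evalMomenta ε g (L a.1 a.2))) := by
  -- This keeps the natural subtraction `u - h` from truncating; `hzb` below does the same for `q_b
  -- - z_b - 1`.
  have hhu : h ≤ u := by
    simpa using (linearIndependent_intCast hm).fintype_card_le_finrank
  have hpos := groupSize_pos hg
  refine ⟨fun b => exists_isMomentumSystem ε g b (hz1 b) (hz2 b) (hpos b), fun i hi => ?_,
    fun Z L hZL => ?_⟩
  · rw [hr1 i hi]
    exact J_eq_hamiltonian hl
  have hzb : ∀ b, z b + 1 ≤ groupSize g b := by
    intro b
    have h1 := hz1 b
    have h2 := hz2 b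
    have h3 := hpos b
    by_cases hb : groupSize g b = 1
    · omega
    · omega
  have hsum : ∑ b, 2 * (groupSize g b - z b - 1) + 2 * ∑ b, z b + 2 * u = 2 * n := by
    have hu : 2 * u = ∑ _b : Fin u, 2 := by simp [mul_comm]
    have hn : 2 * n = ∑ b, 2 * groupSize g b := by rw [← Finset.mul_sum, sum_groupSize]
    rw [hn, hu, Finset.mul_sum, ← Finset.sum_add_distrib, ← Finset.sum_add_distrib]
    refine Finset.sum_congr rfl fun b _ => ?_
    have := hzb b
    omega
  have hcard : Fintype.card (({i : Fin (u - k') // (i : ℕ) < u - h} ⊕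
      {i : Fin h // (i : ℕ) < k'}) ⊕ ((b : Fin u) × Fin (z b))) = u - h + k' + ∑ b, z b := by
    rw [Fintype.card_sum, Fintype.card_sum, card_fin_lt (by omega), card_fin_lt hkh,
      Fintype.card_sigma]
    simp
  refine ⟨?_, ?_, hcard, ?_, ?_, ?_, ?_⟩
  · rintro ((i | i) | a)
    exacts [(contDiff_J ε g _).of_le le_top, (contDiff_imR ε g _).of_le le_top,
      (contDiff_evalMomenta ε g _).of_le le_top]
  · rintro ((i | i) | a)
    exacts [(contDiff_J ε g _).of_le le_top, (contDiff_imR ε g _).of_le le_top,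
      (contDiff_evalMomenta ε g _).of_le le_top]
  · rw [hcard, Fintype.card_sum, Fintype.card_sum, card_fin_ge (by omega), card_fin_ge hkh,
      Fintype.card_sigma]
    simp only [Fintype.card_fin]
    omega
  · have hf : ∀ b, FunctionallyIndependent fun i => evalMomenta ε g (Sum.elim (Z b) (L b) i) := by
      intro b
      convert (hZL b).independent using 1
      ext i
      rcases i with i | i <;> rfl
    -- Independence does not see the division into central and other elements; `φ` forgets it.
    let φ : (({i : Fin (u - k') // (i : ℕ) < u - h} ⊕ {i : Fin h // (i : ℕ) < k'}) ⊕
          ((b : Fin u) × Fin (z b))) ⊕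
        (({i : Fin (u - k') // u - h ≤ (i : ℕ)} ⊕ {i : Fin h // k' ≤ (i : ℕ)}) ⊕
          ((b : Fin u) × Fin (2 * (groupSize g b - z b - 1)))) →
        (Fin (u - k') ⊕ Fin h) ⊕
          ((b : Fin u) × (Fin (z b) ⊕ Fin (2 * (groupSize g b - z b - 1)))) :=
      Sum.elim
        (Sum.elim (Sum.elim (fun i => .inl (.inl i.1)) fun i => .inl (.inr i.1))
          fun a => .inr ⟨a.1, .inl a.2⟩)
        (Sum.elim (Sum.elim (fun i => .inl (.inl i.1)) fun i => .inl (.inr i.1))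
          fun a => .inr ⟨a.1, .inr a.2⟩)
    have hφ : Function.Injective φ := by
      rintro (((⟨i, hi⟩ | ⟨i, hi⟩) | ⟨b, i⟩) | ((⟨i, hi⟩ | ⟨i, hi⟩) | ⟨b, i⟩))
        (((⟨j, hj⟩ | ⟨j, hj⟩) | ⟨b', j⟩) | ((⟨j, hj⟩ | ⟨j, hj⟩) | ⟨b', j⟩)) h <;>
      simp only [φ, Sum.elim_inl, Sum.elim_inr, Sum.inl.injEq, Sum.inr.injEq, Sigma.mk.injEq,
        reduceCtorEq] at h <;>
      first
      | (subst h; first | rfl | omega)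
      | (obtain ⟨rfl, h⟩ := h
         first
         | (simp only [heq_eq_eq, Sum.inl.injEq, Sum.inr.injEq, reduceCtorEq] at h; subst h; rfl)
         | (simp only [heq_eq_eq, reduceCtorEq] at h))
    convert (functionallyIndependent_J_imR_evalMomenta ε g hg hr hm
      (fun b => Sum.elim (Z b) (L b)) hf).comp φ hφ using 1
    ext i
    rcases i with ((i | i) | a) | ((i | i) | a) <;> rfl
  · rintro ((i | i) | a) ((j | j) | a')
    · exact poissonBracket_J_J ε g _ _
    · exact poissonBracket_eq_zero_symm (poissonBracket_imR_J ε g (hrm1 _ _ j.2))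
    · exact poissonBracket_eq_zero_symm (poissonBracket_evalMomenta_J ε g _ _)
    · exact poissonBracket_imR_J ε g (hrm1 _ _ i.2)
    -- The support hypothesis concerns distinct indices only; a function commutes with itself by
    -- antisymmetry.
    · by_cases hij : i = j
      · subst hij
        ext y
        have := poissonBracket_swap (imR ε g (m i.1)) (imR ε g (m i.1)) y
        simp only [Sum.elim_inl, Sum.elim_inr, Pi.zero_apply]
        linarith
      · exact poissonBracket_imR_imR ε g (hmm _ _ j.2 fun h => hij (Subtype.ext h))
    · exact poissonBracket_imR_evalMomenta ε g _ _
    · exact poissonBracket_evalMomenta_J ε g _ _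
    · exact poissonBracket_eq_zero_symm (poissonBracket_imR_evalMomenta ε g _ _)
    · obtain ⟨b, i⟩ := a
      obtain ⟨b', j⟩ := a'
      by_cases hb : b = b'
      · subst hb
        exact (hZL b).involution_Z i j
      · exact poissonBracket_evalMomenta_of_ne ε g hb _ _
  · rintro ((i | i) | a) ((j | j) | a')
    · exact poissonBracket_J_J ε g _ _
    · exact poissonBracket_eq_zero_symm (poissonBracket_imR_J ε g (hrm2 _ _ i.2 j.2))
    · exact poissonBracket_eq_zero_symm (poissonBracket_evalMomenta_J ε g _ _)
    · exact poissonBracket_imR_J ε g (hrm1 _ _ i.2)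
    -- The two indices are distinct because they lie on opposite sides of `k'`.
    · refine poissonBracket_eq_zero_symm (poissonBracket_imR_imR ε g (hmm _ _ i.2 fun h => ?_))
      have h1 := i.2
      have h2 := j.2
      rw [h] at h2
      omega
    · exact poissonBracket_imR_evalMomenta ε g _ _
    · exact poissonBracket_evalMomenta_J ε g _ _
    · exact poissonBracket_eq_zero_symm (poissonBracket_imR_evalMomenta ε g _ _)
    · obtain ⟨b, i⟩ := a
      obtain ⟨b', j⟩ := a'
      by_cases hb : b = b'
      · subst hb
        exact (hZL b).involution_L i j
      · exact poissonBracket_evalMomenta_of_ne ε g hb _ _
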